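/- **Theorem.** Let $r:\mathbb R\to\mathbb R$ be regularly varying at $+\infty$ with index $\gamma>1$ (i.e. $r$ is positive and measurable on some half-line $[A,\infty)$ and $r(cy)/r(y)\to c^\gamma$ as $y\to\infty$ for every $c>0$), and suppose that $$\lim_{n\to\infty}\bigl(r(\log (nx_1))-r(\log (nx_2))\bigr)=-\infty\qquad\text{for all }0<x_1<x_2 .$$ Let $Z_1,Z_2,\dots$ be i.i.d. random variables, non-negative almost surely, with $\mathbf P(Z_1>x)=\exp(-r(\log x))$ for all sufficiently large $x$, and put $$\bar W_n(t)=\frac1n\sum_{i=1}^{\lfloor nt\rfloor}(Z_i-\mathbf E Z_1),\qquad t\in[0,1].$$ Let $\mathbb D$ be the space of càdlàg functions $\xi:[0,1]\to\mathbb R$ with the Skorokhod metric $d_{J_1}(\xi,\zeta)=\inf_{\lambda}\|\lambda-e\|\vee\|\xi\circ\lambda-\zeta\|$, where $\lambda$ runs over the non-decreasing homeomorphisms of $[0,1]$, $e$ is the identity and $\|\cdot\|$ is the supremum norm. Let $\tilde{\mathbb D}_{<\infty}\subset\mathbb D$ be the set of non-decreasing pure jump functions $\xi$ with $\xi(0)=0$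 and finitely many jumps (a jump at time $1$ is allowed), and define $\tilde I:\mathbb D\to[0,\infty]$ by $$\tilde I(\xi)=\#\{t\in[0,1]:\xi(t)\ne\xi(t-)\}\ \text{ if }\xi\in\tilde{\mathbb D}_{<\infty},\qquad \tilde I(\xi)=\infty\ \text{ otherwise,}$$ with the convention $\xi(0-)=0$. Then $(\bar W_n)_{n\ge1}$ satisfies the extended large deviation principle on $(\mathbb D,d_{J_1})$ with rate function $\tilde I$ and speed $r(\log n)$. That is, each $\bar W_n$ is a random element of $\mathbb D$ (for the Borel $\sigma$-algebra), $\tilde I$ is lower semicontinuous, $r(\log n)\to\infty$, and for every open $G\subset\mathbb D$ and every closed $F\subset\mathbb D$ $$-\inf_{\xi\in G}\tilde I(\xi)\le\liminf_{n\to\infty}\frac{\log\mathbf P(\bar W_n\in G)}{r(\log n)},\qquad \limsup_{n\to\infty}\frac{\log\mathbf P(\bar W_n\in F)}{r(\log n)}\le-\lim_{\epsilon\downarrow0}\ \inf_{\xi\in F^\epsilon}\tilde I(\xi),$$ where $F^\epsilon=\{\xi\in\mathbb D:d_{J_1}(\xi,F)\le\epsilon\}$, $\log 0=-\infty$ and $\inf\emptyset=+\infty$.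 -/

import Mathlib

open Filter Topology MeasureTheory ProbabilityTheory
open scoped ENNReal

/-- A càdlàg function `[0,1] → ℝ`: right-continuous with (finite) left limits.
At `t = 0` the left-limit condition is vacuous, since `𝓝[<] 0 = ⊥` in `[0,1]`. -/
structure CadlagPath where
  toFun : unitInterval → ℝ
  right_continuous : ∀ t, ContinuousWithinAt toFun (Set.Ici t) t
  left_limits : ∀ t, ∃ l : ℝ, Tendsto toFun (𝓝[<] t) (𝓝 l)

namespace CadlagPath

instance : CoeFun CadlagPath (fun _ => unitInterval → ℝ) := ⟨CadlagPath.toFun⟩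

noncomputable section

/-- For a time change `lam`: the quantity `‖lam - e‖ ∨ ‖ξ ∘ lam - ζ‖` (suprema over `[0,1]`),
as an element of `[0,∞]`. -/
def timeChangeCost (ξ ζ : CadlagPath) (lam : unitInterval ≃o unitInterval) : ℝ≥0∞ :=
  max (⨆ t, edist (lam t) t) (⨆ t, edist (ξ (lam t)) (ζ t))

/-- The Skorokhod `J₁` distance, the infimum of `‖lam - e‖ ∨ ‖ξ ∘ lam - ζ‖` over all
non-decreasing homeomorphisms `lam` of `[0,1]`; these are exactly the order isomorphisms
of `[0,1]`. -/
def j1Dist (ξ ζ : CadlagPath) : ℝ≥0∞ :=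
  ⨅ lam : unitInterval ≃o unitInterval, timeChangeCost ξ ζ lam

theorem j1Dist_self (ξ : CadlagPath) : j1Dist ξ ξ = 0 := by
  refine le_antisymm ((iInf_le _ (OrderIso.refl unitInterval)).trans ?_) bot_le
  simp [timeChangeCost]

theorem j1Dist_comm_le (ξ ζ : CadlagPath) : j1Dist ξ ζ ≤ j1Dist ζ ξ := by
  refine le_iInf fun lam => (iInf_le _ lam.symm).trans ?_
  refine max_le_max ?_ ?_
  · refine iSup_le fun t => ?_
    refine le_trans ?_ (le_iSup _ (lam.symm t))
    rw [lam.apply_symm_apply, edist_comm]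
  · refine iSup_le fun t => ?_
    refine le_trans ?_ (le_iSup _ (lam.symm t))
    rw [lam.apply_symm_apply, edist_comm]

theorem j1Dist_triangle (ξ ζ η : CadlagPath) : j1Dist ξ η ≤ j1Dist ξ ζ + j1Dist ζ η := by
  unfold j1Dist
  rw [ENNReal.iInf_add]
  refine le_iInf fun lam => ?_
  rw [ENNReal.add_iInf]
  refine le_iInf fun mu => (iInf_le _ (mu.trans lam)).trans ?_
  refine max_le (iSup_le fun t => ?_) (iSup_le fun t => ?_)
  · refine (edist_triangle _ (mu t) _).trans (add_le_add ?_ ?_)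
    · exact (le_iSup (fun s => edist (lam s) s) (mu t)).trans (le_max_left _ _)
    · exact (le_iSup (fun s => edist (mu s) s) t).trans (le_max_left _ _)
  · refine (edist_triangle _ (ζ (mu t)) _).trans (add_le_add ?_ ?_)
    · exact (le_iSup (fun s => edist (ξ (lam s)) (ζ s)) (mu t)).trans (le_max_right _ _)
    · exact (le_iSup (fun s => edist (ζ (mu s)) (η s)) t).trans (le_max_right _ _)

/-- The Skorokhod space `(D[0,1], d_{J₁})`. -/
instance : PseudoEMetricSpace CadlagPath where
  edist := j1Dist
  edist_self := j1Dist_self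
  edist_comm ξ ζ := le_antisymm (j1Dist_comm_le ξ ζ) (j1Dist_comm_le ζ ξ)
  edist_triangle := j1Dist_triangle

/-- The Borel σ-algebra of the `J₁` topology. -/
instance : MeasurableSpace CadlagPath := borel CadlagPath

instance : BorelSpace CadlagPath := ⟨rfl⟩

/-- The left limit `ξ(t-)`, with the convention `ξ(0-) = 0`. -/
def leftLimit (ξ : CadlagPath) (t : unitInterval) : ℝ :=
  if t = 0 then 0 else Function.leftLim ξ.toFun t

/-- The set of jump times `{t ∈ [0,1] : ξ(t) ≠ ξ(t-)}`. -/
def jumpTimes (ξ : CadlagPath) : Set unitInterval := {t | ξ t ≠ ξ.leftLimit t}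

/-- The number of jumps, in `{0, 1, 2, …, ∞}`. -/
def numJumps (ξ : CadlagPath) : ℕ∞ := ξ.jumpTimes.encard

/-- A pure jump function: its value at `t` is the sum of its jumps up to and including `t`. -/
def IsPureJump (ξ : CadlagPath) : Prop :=
  ∀ t : unitInterval, HasSum (fun s : Set.Iic t => ξ s - ξ.leftLimit s) (ξ t)

/-- Non-decreasing pure jump paths `ξ` with `ξ(0) = 0` and exactly `j` jumps
(a jump at time `1` is allowed). -/
def stepPathsEq (j : ℕ) : Set CadlagPath :=
  {ξ | Monotone ξ.toFun ∧ ξ.IsPureJump ∧ ξ 0 = 0 ∧ ξ.numJumps = j}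

/-- Non-decreasing pure jump paths `ξ` with `ξ(0) = 0` and finitely many jumps. -/
def stepPaths : Set CadlagPath := ⋃ j : ℕ, stepPathsEq j

open Classical in
/-- The number of jumps on `stepPaths`, and `∞` elsewhere. -/
def jumpRate (ξ : CadlagPath) : ℝ≥0∞ :=
  if ξ ∈ stepPaths then (ξ.numJumps : ℝ≥0∞) else ⊤

theorem walk_right_aux (n : ℕ) (w : ℕ → ℝ) (t : unitInterval) :
    ContinuousWithinAt (fun s : unitInterval => w ⌊(n : ℝ) * s⌋₊) (Set.Ici t) t := by
  have hopen : ∀ᶠ s : unitInterval in 𝓝 t, (n : ℝ) * s < ⌊(n : ℝ) * t⌋₊ + 1 :=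
    (Continuous.tendsto (by fun_prop : Continuous fun s : unitInterval => (n : ℝ) * s) t).eventually
      (gt_mem_nhds (Nat.lt_floor_add_one _))
  have hev : (fun s : unitInterval => w ⌊(n : ℝ) * s⌋₊) =ᶠ[𝓝[≥] t]
      fun _ => w ⌊(n : ℝ) * t⌋₊ := by
    filter_upwards [mem_nhdsWithin_of_mem_nhds hopen, self_mem_nhdsWithin] with s hs hts
    have h1 : ⌊(n : ℝ) * t⌋₊ ≤ ⌊(n : ℝ) * s⌋₊ :=
      Nat.floor_mono (mul_le_mul_of_nonneg_left hts (Nat.cast_nonneg n))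
    have h2 : ⌊(n : ℝ) * s⌋₊ < ⌊(n : ℝ) * t⌋₊ + 1 := by
      rw [Nat.floor_lt (mul_nonneg (Nat.cast_nonneg n) s.2.1)]
      exact_mod_cast hs
    have h3 : ⌊(n : ℝ) * s⌋₊ = ⌊(n : ℝ) * t⌋₊ := by omega
    simp only [h3]
  exact (tendsto_const_nhds.congr' hev.symm)

theorem walk_left_aux (n : ℕ) (w : ℕ → ℝ) (t : unitInterval) :
    ∃ l : ℝ, Tendsto (fun s : unitInterval => w ⌊(n : ℝ) * s⌋₊) (𝓝[<] t) (𝓝 l) := by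
  rcases Nat.eq_zero_or_pos n with rfl | hn
  · exact ⟨w 0, by simpa using tendsto_const_nhds⟩
  have hn' : (0 : ℝ) < n := by exact_mod_cast hn
  have hk : (⌈(n : ℝ) * t⌉₊ : ℝ) - 1 < (n : ℝ) * t := by
    have := Nat.ceil_lt_add_one (mul_nonneg (Nat.cast_nonneg n) t.2.1 : (0 : ℝ) ≤ n * t)
    linarith
  have hopen : ∀ᶠ s : unitInterval in 𝓝 t, (⌈(n : ℝ) * t⌉₊ : ℝ) - 1 < (n : ℝ) * s :=
    (Continuous.tendsto (by fun_prop : Continuous fun s : unitInterval => (n : ℝ) * s) t).eventually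
      (lt_mem_nhds hk)
  refine ⟨w (⌈(n : ℝ) * t⌉₊ - 1), ?_⟩
  refine tendsto_const_nhds.congr' ?_
  filter_upwards [mem_nhdsWithin_of_mem_nhds hopen, self_mem_nhdsWithin] with s hs hst
  have hs0 : (0 : ℝ) ≤ n * s := mul_nonneg (Nat.cast_nonneg n) s.2.1
  have hst' : (n : ℝ) * s < n * t := mul_lt_mul_of_pos_left hst hn'
  have hpos : 0 < ⌈(n : ℝ) * t⌉₊ := Nat.ceil_pos.2 (lt_of_le_of_lt hs0 hst')
  have hcast : ((⌈(n : ℝ) * t⌉₊ - 1 : ℕ) : ℝ) = (⌈(n : ℝ) * t⌉₊ : ℝ) - 1 := by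
    rw [Nat.cast_sub hpos]; simp
  have h3 : ⌊(n : ℝ) * s⌋₊ = ⌈(n : ℝ) * t⌉₊ - 1 := by
    rw [Nat.floor_eq_iff hs0, hcast]
    exact ⟨hs.le, by have := Nat.le_ceil ((n : ℝ) * t); linarith⟩
  rw [h3]

/-- The path `t ↦ (1/n) ∑_{i ≤ ⌊n t⌋} (z_i - m)`, where the increments `z₁, z₂, …` are
`z 0, z 1, …`. -/
def centeredWalk (n : ℕ) (z : ℕ → ℝ) (m : ℝ) : CadlagPath where
  toFun t := (1 / (n : ℝ)) * ∑ i ∈ Finset.range ⌊(n : ℝ) * t⌋₊, (z i - m)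
  right_continuous t :=
    walk_right_aux n (fun k => (1 / (n : ℝ)) * ∑ i ∈ Finset.range k, (z i - m)) t
  left_limits t :=
    walk_left_aux n (fun k => (1 / (n : ℝ)) * ∑ i ∈ Finset.range k, (z i - m)) t

end

end CadlagPath

/-- `r` is regularly varying (at `+∞`) with index `γ`: it is positive and measurable on some
half-line `[A, ∞)` and `r(c y) / r(y) → c ^ γ` as `y → ∞` for every `c > 0`. -/
def IsRegularlyVarying (r : ℝ → ℝ) (γ : ℝ) : Prop :=
  (∃ A : ℝ, (∀ y, A ≤ y → 0 < r y) ∧ Measurable ((Set.Ici A).domRestrict r)) ∧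
    ∀ c : ℝ, 0 < c → Tendsto (fun y => r (c * y) / r y) atTop (𝓝 (c ^ γ))

/-- The extended large deviation principle for a sequence of measures on a metric space, with
rate function `I` (lower semicontinuous, values in `[0,∞]`) and speed `a n → ∞`:
`-inf_G I ≤ liminf log μ_n(G) / a_n` for `G` open, and
`limsup log μ_n(F) / a_n ≤ -lim_{ε ↓ 0} inf_{F^ε} I` for `F` closed, where
`F^ε = {x : d(x, F) ≤ ε}` is the closed `ε`-fattening (`Metric.cthickening`). -/
def ExtendedLDP {X : Type*} [PseudoEMetricSpace X] [MeasurableSpace X]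
    (μ : ℕ → Measure X) (I : X → ℝ≥0∞) (a : ℕ → ℝ) : Prop :=
  LowerSemicontinuous I ∧
  Tendsto a atTop atTop ∧
  (∀ G : Set X, IsOpen G →
    -((⨅ x ∈ G, I x : ℝ≥0∞) : EReal) ≤
      liminf (fun n => ENNReal.log (μ n G) / (a n : EReal)) atTop) ∧
  (∀ F : Set X, IsClosed F → ∃ L : ℝ≥0∞,
    Tendsto (fun ε : ℝ => ⨅ x ∈ Metric.cthickening ε F, I x) (𝓝[>] 0) (𝓝 L) ∧
      limsup (fun n => ENNReal.log (μ n F) / (a n : EReal)) atTop ≤ -(L : EReal))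

/-- A sequence of random elements of `X` satisfies the extended large deviation principle
if their laws do. -/
def SatisfiesExtendedLDP {Ω : Type*} [MeasurableSpace Ω] (P : Measure Ω)
    {X : Type*} [PseudoEMetricSpace X] [MeasurableSpace X]
    (Y : ℕ → Ω → X) (I : X → ℝ≥0∞) (a : ℕ → ℝ) : Prop :=
  (∀ n, Measurable (Y n)) ∧ ExtendedLDP (fun n => P.map (Y n)) I a

/-! Large deviations of the walk come from finitely many big increments. An increment of order `n`
has probability about `exp(-r(log n))` whatever its exact size, because `r(y + c) ~ r(y)`. Since `γ
> 1` gives `log n = o(r(log n))`, the at most `n^j` choices of positions are free, so `j` jumps cost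
exactly `j` times the speed.

Upper bound (`expUpperBound_centeredWalk_mem`): truncate the increments at `n^(1/4)`. By Hoeffding
the centred truncated sums stay small except with probability of order `n exp(-c √n)`, which beats
every multiple of `r(log n)`, as `r` grows at most polynomially. Since `r(log n / 4) ~ 4^(-γ) r(log
n)`, having `M` increments above `n^(1/4)` is negligible for large `M`; fewer than `M` of them, each
at most `nδ`, move the path by at most `Mδ`. So, unless `k + 1` increments exceed `nδ`, the walk is
uniformly close to a path with at most `k` jumps (`exists_jumpRate_le_edist_le`). Such closeness is
excluded when the walk lies in `F` and a fattening of `F` has rate at least `k + 1`; this is why the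
fattening appears.

Lower bound (`neg_natCast_le_liminf`): for a step path in `G`, let the increment number `⌈n u⌉` lie
just above `n` times the jump at `u`, for every jump time `u`, and let the other increments obey a
law of large numbers. The gap hypothesis keeps at least half of the tail mass in each window,
independence multiplies the costs, and a time change aligns the jump times
(`edist_centeredWalk_le`).

Lower semicontinuity rests on `jumpRate_le_iff`, which describes the sublevel sets through the
number of values taken. Throughout, `r` is eventually monotone because a tail probability is, and
this makes elementary doubling and sandwich arguments sufficient. -/

/-- Distinct points of a finite set are uniformly separated. -/
lemma Finset.exists_pos_le_dist {X : Type*} [MetricSpace X] (T : Finset X) :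
    ∃ δ > 0, ∀ a ∈ T, ∀ b ∈ T, a ≠ b → δ ≤ dist a b := by
  classical
  have h : ∀ᶠ δ in 𝓝[>] (0 : ℝ), ∀ p ∈ T ×ˢ T, p.1 ≠ p.2 → δ ≤ dist p.1 p.2 := by
    rw [Filter.eventually_all_finset]
    intro p _
    by_cases hp : p.1 = p.2
    · simp [hp]
    · filter_upwards [Ioo_mem_nhdsGT (dist_pos.2 hp)] with δ hδ _ using hδ.2.le
  obtain ⟨δ, h, hδ⟩ := (h.and self_mem_nhdsWithin).exists
  exact ⟨δ, hδ, fun a ha b hb => h (a, b) (Finset.mem_product.2 ⟨ha, hb⟩)⟩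

/-! ### Step paths and lower semicontinuity of the jump count. -/

namespace CadlagPath

lemma edist_le_of_timeChange {ξ ζ : CadlagPath} {e : ℝ} (lam : unitInterval ≃o unitInterval)
    (h₁ : ∀ t, |(lam t : ℝ) - t| ≤ e) (h₂ : ∀ t, |ξ (lam t) - ζ t| ≤ e) :
    edist ξ ζ ≤ ENNReal.ofReal e := by
  refine (iInf_le _ lam).trans (max_le (iSup_le fun t => ?_) (iSup_le fun t => ?_))
  · rw [edist_dist]
    exact ENNReal.ofReal_le_ofReal (h₁ t)
  · rw [edist_dist]
    exact ENNReal.ofReal_le_ofReal (h₂ t)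

lemma edist_le_of_forall {ξ ζ : CadlagPath} {e : ℝ} (h : ∀ t, |ξ t - ζ t| ≤ e) :
    edist ξ ζ ≤ ENNReal.ofReal e :=
  edist_le_of_timeChange (OrderIso.refl _)
    (fun t => by simpa using (abs_nonneg _).trans (h t)) h

lemma exists_timeChange_of_edist_lt {ξ ζ : CadlagPath} {e : ℝ}
    (h : edist ξ ζ < ENNReal.ofReal e) :
    ∃ lam : unitInterval ≃o unitInterval, ∀ t, |ξ (lam t) - ζ t| < e := by
  obtain ⟨lam, hlam⟩ := iInf_lt_iff.1 h
  refine ⟨lam, fun t => ?_⟩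
  have h1 := ((le_iSup (fun s => edist (ξ (lam s)) (ζ s)) t).trans (le_max_right _ _)).trans_lt hlam
  rw [edist_dist] at h1
  exact (ENNReal.ofReal_lt_ofReal_iff_of_nonneg dist_nonneg).1 h1

lemma leftLimit_zero (ξ : CadlagPath) : ξ.leftLimit 0 = 0 := if_pos rfl

lemma tendsto_leftLimit (ξ : CadlagPath) (t : unitInterval) :
    Tendsto ξ.toFun (𝓝[<] t) (𝓝 (ξ.leftLimit t)) := by
  by_cases ht : t = 0
  · have : Set.Iio t = ∅ := by
      ext s
      simp [ht]
    simp [this]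
  · rw [leftLimit, if_neg ht]
    exact tendsto_leftLim_of_tendsto (ξ.left_limits t)

lemma leftLimit_le (ξ : CadlagPath) (hξ : Monotone ξ.toFun) (h0 : ξ 0 = 0) (t : unitInterval) :
    ξ.leftLimit t ≤ ξ t := by
  by_cases ht : t = 0
  · rw [ht, leftLimit_zero, h0]
  · rw [leftLimit, if_neg ht]
    exact hξ.leftLim_le le_rfl

lemma le_leftLimit (ξ : CadlagPath) (hξ : Monotone ξ.toFun) {s t : unitInterval} (hst : s < t) :
    ξ s ≤ ξ.leftLimit t := by
  rw [leftLimit, if_neg ((unitInterval.nonneg' : 0 ≤ s).trans_lt hst).ne']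
  exact hξ.le_leftLim hst

/-- The sum of the jumps of `ξ` at the times of `J` up to time `t`. -/
noncomputable def jumpSum (ξ : CadlagPath) (J : Finset unitInterval) (t : unitInterval) : ℝ :=
  ∑ s ∈ J, if s ≤ t then ξ s - ξ.leftLimit s else 0

/-- The summand vanishes off the jump times, so the series is a finite sum and uniqueness of sums
gives both directions. -/
lemma isPureJump_iff (ξ : CadlagPath) (hJ : ξ.jumpTimes.Finite) :
    ξ.IsPureJump ↔ ∀ t, ξ t = ξ.jumpSum hJ.toFinset t := by
  refine forall_congr' fun t => ?_
  have h : HasSum (fun s : Set.Iic t => ξ s - ξ.leftLimit s) (ξ.jumpSum hJ.toFinset t) := by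
    have h1 := hasSum_subtype_iff_indicator (f := fun s => ξ s - ξ.leftLimit s)
      (a := ξ.jumpSum hJ.toFinset t) (s := Set.Iic t)
    refine h1.2 ?_
    have h2 : ξ.jumpSum hJ.toFinset t =
        ∑ s ∈ hJ.toFinset, (Set.Iic t).indicator (fun s => ξ s - ξ.leftLimit s) s := by
      simp [jumpSum, Set.indicator_apply]
    rw [h2]
    refine hasSum_sum_of_ne_finset_zero fun b hb => ?_
    have : ξ b = ξ.leftLimit b := by simpa [jumpTimes] using hb
    simp [Set.indicator_apply, this]
  exact ⟨fun h' => h'.unique h, fun h' => h' ▸ h⟩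

/-- Approached from the left, `jumpSum` loses exactly the term at `t`, which is the jump of `ξ`
there; from the right both functions are continuous. -/
lemma continuous_sub_jumpSum (ξ : CadlagPath) (hJ : ξ.jumpTimes.Finite) :
    Continuous fun t => ξ t - ξ.jumpSum hJ.toFinset t := by
  refine continuous_iff_continuousAt.2 fun t => continuousAt_iff_continuous_left_right.2 ⟨?_, ?_⟩
  · rw [← continuousWithinAt_Iio_iff_Iic]
    have hS : Tendsto (ξ.jumpSum hJ.toFinset) (𝓝[<] t)
        (𝓝 (∑ s ∈ hJ.toFinset, if s < t then ξ s - ξ.leftLimit s else 0)) := by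
      refine tendsto_finsetSum _ fun s _ => tendsto_const_nhds.congr' ?_
      rcases lt_or_ge s t with hst | hst
      · filter_upwards [mem_nhdsWithin_of_mem_nhds (Ioi_mem_nhds hst)] with x hx
        simp [hst, (Set.mem_Ioi.1 hx).le]
      · filter_upwards [self_mem_nhdsWithin] with x hx
        rw [if_neg hst.not_gt, if_neg ((Set.mem_Iio.1 hx).trans_le hst).not_ge]
    have hd : ξ.jumpSum hJ.toFinset t =
        (∑ s ∈ hJ.toFinset, if s < t then ξ s - ξ.leftLimit s else 0) +
          (ξ t - ξ.leftLimit t) := by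
      have h1 : ξ t - ξ.leftLimit t =
          ∑ s ∈ hJ.toFinset, if s = t then ξ s - ξ.leftLimit s else 0 := by
        rw [Finset.sum_ite_eq']
        split_ifs with h
        · rfl
        · have : ξ t = ξ.leftLimit t := by simpa [jumpTimes] using h
          rw [this, sub_self]
      rw [h1, ← Finset.sum_add_distrib, jumpSum]
      refine Finset.sum_congr rfl fun s _ => ?_
      rcases lt_trichotomy s t with h | h | h
      · simp [h.le, h.ne, h]
      · simp [h]
      · simp [h.not_ge, h.ne', h.not_gt]
    have := (ξ.tendsto_leftLimit t).sub hS
    rw [ContinuousWithinAt, hd]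
    convert! this using 2
    ring
  · refine (ξ.right_continuous t).sub ?_
    refine tendsto_finsetSum _ fun s _ => tendsto_const_nhds.congr' ?_
    rcases le_or_gt s t with hst | hst
    · filter_upwards [self_mem_nhdsWithin] with x hx
      rw [if_pos hst, if_pos (hst.trans hx)]
    · filter_upwards [mem_nhdsWithin_of_mem_nhds (Iio_mem_nhds hst)] with x hx
      rw [if_neg hst.not_ge, if_neg (Set.mem_Iio.1 hx).not_ge]

lemma notMem_jumpTimes_zero (ξ : CadlagPath) (h0 : ξ 0 = 0) : (0 : unitInterval) ∉ ξ.jumpTimes := by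
  simp [jumpTimes, leftLimit_zero, h0]

/-- A path is injective on its jump times together with `0`: before a jump it stays below the left
limit, which lies strictly below the new value. -/
lemma numJumps_add_one_le (ξ : CadlagPath) (hξ : Monotone ξ.toFun) (h0 : ξ 0 = 0) :
    ξ.numJumps + 1 ≤ (Set.range ξ.toFun).encard := by
  have hlt : ∀ s t, s < t → t ∈ ξ.jumpTimes → ξ s < ξ t := fun s t hst ht =>
    (ξ.le_leftLimit hξ hst).trans_lt
      (lt_of_le_of_ne (ξ.leftLimit_le hξ h0 t) (Ne.symm ht))
  rw [numJumps, ← Set.encard_insert_of_notMem (ξ.notMem_jumpTimes_zero h0)]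
  refine Set.encard_le_encard_of_injOn (f := ξ.toFun) (fun t _ => ⟨t, rfl⟩) ?_
  have key : ∀ s ∈ insert 0 ξ.jumpTimes, ∀ t ∈ insert 0 ξ.jumpTimes, s < t → ξ s < ξ t := by
    intro s _ t ht hst
    refine hlt s t hst (ht.resolve_left ?_)
    rintro rfl
    exact (unitInterval.nonneg' : 0 ≤ s).not_gt hst
  intro s hs t ht hst
  by_contra hne
  rcases lt_or_gt_of_ne hne with h | h
  · exact (key s hs t ht h).ne hst
  · exact (key t ht s hs h).ne' hst

lemma finite_jumpTimes_of_finite_range (ξ : CadlagPath) (hξ : Monotone ξ.toFun) (h0 : ξ 0 = 0)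
    (hfin : (Set.range ξ.toFun).Finite) : ξ.jumpTimes.Finite := by
  have h := ξ.numJumps_add_one_le hξ h0
  rw [← Set.encard_lt_top_iff] at hfin ⊢
  exact lt_of_le_of_lt (le_self_add.trans h) hfin

/-- The path minus its jump sum is continuous with finite range on a connected interval, hence
constant, and it vanishes at `0`. -/
lemma isPureJump_of_finite_range (ξ : CadlagPath) (hξ : Monotone ξ.toFun) (h0 : ξ 0 = 0)
    (hfin : (Set.range ξ.toFun).Finite) : ξ.IsPureJump := by
  have hJ := ξ.finite_jumpTimes_of_finite_range hξ h0 hfin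
  rw [ξ.isPureJump_iff hJ]
  have hS : (Set.range (ξ.jumpSum hJ.toFinset)).Finite := by
    refine ((hJ.toFinset.powerset.finite_toSet).image
      fun A => ∑ s ∈ A, (ξ s - ξ.leftLimit s)).subset ?_
    rintro _ ⟨t, rfl⟩
    refine ⟨hJ.toFinset.filter (· ≤ t), by simp, ?_⟩
    exact Finset.sum_filter _ _
  have hr : (Set.range fun t => ξ t - ξ.jumpSum hJ.toFinset t).Finite := by
    refine (hfin.image2 (fun a b => a - b) hS).subset ?_
    rintro _ ⟨t, rfl⟩
    exact ⟨_, ⟨t, rfl⟩, _, ⟨t, rfl⟩, rfl⟩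
  have hsub : (Set.range fun t => ξ t - ξ.jumpSum hJ.toFinset t).Subsingleton :=
    hr.countable.isTotallyDisconnected _ subset_rfl
      (isPreconnected_range (ξ.continuous_sub_jumpSum hJ))
  intro t
  have h1 := hsub ⟨t, rfl⟩ ⟨0, rfl⟩
  have h2 : ξ.jumpSum hJ.toFinset 0 = 0 := by
    refine Finset.sum_eq_zero fun s hs => if_neg fun hs0 => ?_
    have : s = 0 := le_antisymm hs0 unitInterval.nonneg'
    exact ξ.notMem_jumpTimes_zero h0 (by simpa [this] using hs)
  simp only [h0, h2] at h1
  linarith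

lemma encard_range_le_of_factors {β : Type*} (f : unitInterval → β) (N : unitInterval → ℕ) (j : ℕ)
    (hN : ∀ t, N t ≤ j) (h : ∀ s t, N s = N t → f s = f t) :
    (Set.range f).encard ≤ j + 1 := by
  have : Nonempty β := ⟨f 0⟩
  have hf : Function.FactorsThrough f N := fun s t hst => h s t hst
  have h1 : Set.range f ⊆ Function.extend N f (fun _ => f 0) '' (Finset.range (j + 1) : Set ℕ) := by
    rintro _ ⟨t, rfl⟩
    exact ⟨N t, by simpa using Nat.lt_succ_of_le (hN t), hf.extend_apply _ t⟩
  refine (Set.encard_le_encard h1).trans ((Set.encard_image_le _ _).trans ?_)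
  rw [Set.encard_coe_eq_coe_finsetCard, Finset.card_range]
  norm_cast

/-- The sets of jump times up to `t` are nested, so their cardinality determines them and hence the
value at `t`. -/
lemma encard_range_le_of_mem_stepPathsEq {ξ : CadlagPath} {j : ℕ} (h : ξ ∈ stepPathsEq j) :
    (Set.range ξ.toFun).encard ≤ j + 1 := by
  obtain ⟨-, hp, -, hj⟩ := h
  have hJ : ξ.jumpTimes.Finite := Set.finite_of_encard_eq_coe hj
  rw [ξ.isPureJump_iff hJ] at hp
  have hcard : hJ.toFinset.card = j := by
    have := hJ.encard_eq_coe_toFinset_card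
    rw [numJumps, this] at hj
    exact_mod_cast hj
  refine encard_range_le_of_factors _ (fun t => (hJ.toFinset.filter (· ≤ t)).card) j
    (fun t => (Finset.card_filter_le _ _).trans hcard.le) fun s t hst => ?_
  rw [hp s, hp t, jumpSum, jumpSum, ← Finset.sum_filter, ← Finset.sum_filter]
  congr 1
  rcases le_total s t with h | h
  · exact Finset.eq_of_subset_of_card_le
      (Finset.monotone_filter_right _ fun x _ hx => hx.trans h) hst.ge
  · exact (Finset.eq_of_subset_of_card_le
      (Finset.monotone_filter_right _ fun x _ hx => hx.trans h) hst.le).symm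

lemma jumpRate_eq (ξ : CadlagPath) : jumpRate ξ = ⊤ ∨ ∃ j : ℕ, ξ ∈ stepPathsEq j ∧ jumpRate ξ = j := by
  by_cases h : ξ ∈ stepPaths
  · right
    obtain ⟨j, hj⟩ := Set.mem_iUnion.1 h
    refine ⟨j, hj, ?_⟩
    rw [jumpRate, if_pos h, hj.2.2.2]
    simp
  · left
    rw [jumpRate, if_neg h]

/-- This form suits `J₁` limits: time changes preserve monotonicity, the value at `0` and the range,
so only uniform approximation of values remains. -/
lemma jumpRate_le_iff (ξ : CadlagPath) (j : ℕ) :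
    jumpRate ξ ≤ j ↔ Monotone ξ.toFun ∧ ξ 0 = 0 ∧ (Set.range ξ.toFun).encard ≤ j + 1 := by
  constructor
  · intro h
    rcases ξ.jumpRate_eq with h' | ⟨i, hi, h'⟩
    · simp [h'] at h
    · refine ⟨hi.1, hi.2.2.1, (encard_range_le_of_mem_stepPathsEq hi).trans ?_⟩
      rw [h'] at h
      have : i ≤ j := by exact_mod_cast h
      gcongr
  · rintro ⟨h1, h2, h3⟩
    have hfin : (Set.range ξ.toFun).Finite := by
      rw [← Set.encard_lt_top_iff]
      exact h3.trans_lt (by exact_mod_cast ENat.natCast_lt_top (j + 1))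
    have hle : ξ.numJumps ≤ j := by
      have := (ξ.numJumps_add_one_le h1 h2).trans h3
      exact (ENat.add_le_add_iff_right (by simp)).1 this
    obtain ⟨i, hi⟩ := ENat.ne_top_iff_exists.1 (hle.trans_lt (ENat.natCast_lt_top j)).ne
    have hm : ξ ∈ stepPaths := Set.mem_iUnion.2
      ⟨i, h1, ξ.isPureJump_of_finite_range h1 h2 hfin, h2, hi.symm⟩
    rw [jumpRate, if_pos hm]
    exact (ENat.toENNReal_le.2 hle).trans (by simp)

lemma isClosed_jumpRate_le (j : ℕ) : IsClosed {ξ : CadlagPath | jumpRate ξ ≤ j} := by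
  refine isClosed_of_closure_subset fun ξ hξ => ?_
  have happ : ∀ e : ℝ, 0 < e → ∃ ζ : CadlagPath, jumpRate ζ ≤ j ∧
      ∃ lam : unitInterval ≃o unitInterval, ∀ t, |ξ (lam t) - ζ t| < e := by
    intro e he
    obtain ⟨ζ, hζ, hd⟩ := EMetric.mem_closure_iff.1 hξ (ENNReal.ofReal e) (by simpa using he)
    exact ⟨ζ, hζ, exists_timeChange_of_edist_lt hd⟩
  refine (ξ.jumpRate_le_iff j).2 ⟨?_, ?_, ?_⟩
  · intro s t hst
    refine le_of_forall_pos_le_add fun e he => ?_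
    obtain ⟨ζ, hζ, lam, hlam⟩ := happ (e / 2) (half_pos he)
    have hm := ((ζ.jumpRate_le_iff j).1 hζ).1 (lam.symm.monotone hst)
    have h1 := abs_lt.1 (hlam (lam.symm s))
    have h2 := abs_lt.1 (hlam (lam.symm t))
    rw [lam.apply_symm_apply] at h1 h2
    change ξ s ≤ ξ t + e
    linarith
  · refine abs_eq_zero.1 (le_antisymm (le_of_forall_pos_le_add fun e he => ?_) (abs_nonneg _))
    obtain ⟨ζ, hζ, lam, hlam⟩ := happ e he
    have h1 := hlam 0
    have h2 : lam 0 = 0 := lam.map_bot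
    rw [h2, ((ζ.jumpRate_le_iff j).1 hζ).2.1, sub_zero] at h1
    linarith
  · by_contra! hlt
    -- If `ξ` took `j + 2` values, pairwise `δ` apart, an approximant within `δ / 2` would take `j +
    -- 2` distinct values as well.
    obtain ⟨T, hT, hTc⟩ := Set.exists_subset_encard_eq (Order.add_one_le_of_lt hlt)
    have hTf : T.Finite := Set.finite_of_encard_eq_coe (k := j + 1 + 1) (by rw [hTc]; norm_cast)
    obtain ⟨δ, hδ, hsep⟩ := hTf.toFinset.exists_pos_le_dist
    obtain ⟨ζ, hζ, lam, hlam⟩ := happ (δ / 2) (half_pos hδ)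
    have hc := ((ζ.jumpRate_le_iff j).1 hζ).2.2
    have hex : ∀ a ∈ T, ∃ s, |a - ζ s| < δ / 2 := by
      intro a ha
      obtain ⟨s, rfl⟩ := hT ha
      refine ⟨lam.symm s, ?_⟩
      simpa using hlam (lam.symm s)
    choose! g hg using hex
    have hle : T.encard ≤ (Set.range ζ.toFun).encard := by
      refine Set.encard_le_encard_of_injOn (f := fun a => ζ (g a)) (fun a _ => ⟨_, rfl⟩) ?_
      intro a ha b hb hab
      by_contra hne
      have h1 := hsep a (by simpa using ha) b (by simpa using hb) hne
      have h2 := abs_lt.1 (hg a ha)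
      have h3 := abs_lt.1 (hg b hb)
      simp only at hab
      rw [Real.dist_eq] at h1
      rw [hab] at h2
      have : |a - b| < δ := abs_lt.2 ⟨by linarith, by linarith⟩
      linarith
    rw [hTc] at hle
    have := hle.trans hc
    have h4 : j + 1 + 1 ≤ j + 1 := by exact_mod_cast this
    omega

lemma lowerSemicontinuous_jumpRate : LowerSemicontinuous jumpRate := by
  refine lowerSemicontinuous_iff_isClosed_preimage.2 fun y => ?_
  rcases eq_or_ne y ⊤ with rfl | hy
  · simp
  lift y to NNReal using hy
  -- Finite rates are integers, so the level `y` may be rounded down.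
  convert isClosed_jumpRate_le ⌊y⌋₊ using 1
  ext ξ
  rcases ξ.jumpRate_eq with h | ⟨j, -, h⟩
  · simp [h]
  · simp only [Set.mem_preimage, Set.mem_Iic, Set.mem_ofPred_eq, h, Nat.cast_le]
    rw [Nat.le_floor_iff zero_le]
    norm_cast

end CadlagPath

/-! ### Time changes, and the walk as a random path. -/

namespace CadlagPath

/-- Finitely many positive times can be moved, by small amounts, by a time change which is
uniformly close to the identity. -/
lemma exists_timeChange_moving (J : Finset unitInterval) (hJ : 0 ∉ J) :
    ∃ c > 0, ∀ (v : unitInterval → unitInterval) (d : ℝ), d < c →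
      (∀ u ∈ J, u = 1 → v u = 1) → (∀ u ∈ J, |(v u : ℝ) - u| ≤ d) →
      ∃ lam : unitInterval ≃o unitInterval,
        (∀ u ∈ J, lam u = v u) ∧ ∀ t, |(lam t : ℝ) - t| ≤ J.card * d := by
  classical
  -- The endpoints are included so that the perturbation below fixes `0` and `1`.
  obtain ⟨ρ, hρ, hsep⟩ := (insert 0 (insert 1 J)).exists_pos_le_dist
  have hsep' : ∀ a ∈ insert 0 (insert 1 J), ∀ u ∈ J, a ≠ u → 1 - |(a : ℝ) - u| / ρ ≤ 0 := by
    intro a ha u hu hau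
    have := hsep a ha u (by simp [hu]) hau
    rw [Subtype.dist_eq, Real.dist_eq] at this
    rw [sub_nonpos, le_div_iff₀ hρ]
    linarith
  -- The perturbation has Lipschitz constant at most `J.card * d / ρ`, which this threshold keeps
  -- below `1`; hence `g` is strictly increasing.
  refine ⟨ρ / (J.card + 1), by positivity, fun v d hd hv1 hvd => ?_⟩
  rw [lt_div_iff₀ (by positivity)] at hd
  -- A tent of height `1` and half-width `ρ` at each node; it vanishes at all other nodes, so `g`
  -- sends `u` exactly to `v u`.
  set h : unitInterval → ℝ → ℝ := fun u t => max (1 - |t - u| / ρ) 0 with hh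
  have hh0 : ∀ u t, 0 ≤ h u t := fun u t => le_max_right _ _
  have hh1 : ∀ u t, h u t ≤ 1 := fun u t => max_le (sub_le_self _ (by positivity)) zero_le_one
  have hlip : ∀ u s t, |h u t - h u s| ≤ |t - s| / ρ := by
    intro u s t
    refine (abs_max_sub_max_le_abs _ _ _).trans ?_
    rw [sub_sub_sub_cancel_left, ← sub_div, abs_div, abs_of_pos hρ]
    refine div_le_div_of_nonneg_right ((abs_abs_sub_abs_le _ _).trans (le_of_eq ?_)) hρ.le
    rw [sub_sub_sub_cancel_right, abs_sub_comm]
  have hself : ∀ u : unitInterval, h u u = 1 := fun u => by simp [hh]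
  have hoff : ∀ a ∈ insert 0 (insert 1 J), ∀ u ∈ J, a ≠ u → h u a = 0 := fun a ha u hu hau =>
    max_eq_right (hsep' a ha u hu hau)
  set g : ℝ → ℝ := fun t => t + ∑ u ∈ J, ((v u : ℝ) - u) * h u t with hg
  have hgd : ∀ t, |g t - t| ≤ J.card * d := by
    intro t
    rw [hg, add_sub_cancel_left, ← nsmul_eq_mul, ← Finset.sum_const]
    refine (Finset.abs_sum_le_sum_abs _ _).trans (Finset.sum_le_sum fun u hu => ?_)
    rw [abs_mul, abs_of_nonneg (hh0 u t)]
    exact (mul_le_of_le_one_right (abs_nonneg _) (hh1 u t)).trans (hvd u hu)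
  have hmono : StrictMono g := by
    intro s t hst
    have h1 : |∑ u ∈ J, ((v u : ℝ) - u) * h u t - ∑ u ∈ J, ((v u : ℝ) - u) * h u s|
        ≤ J.card * (d * ((t - s) / ρ)) := by
      rw [← Finset.sum_sub_distrib, ← nsmul_eq_mul, ← Finset.sum_const]
      refine (Finset.abs_sum_le_sum_abs _ _).trans (Finset.sum_le_sum fun u hu => ?_)
      rw [← mul_sub, abs_mul]
      have h2 := hlip u s t
      rw [abs_of_pos (sub_pos.2 hst)] at h2
      exact mul_le_mul (hvd u hu) h2 (abs_nonneg _) ((abs_nonneg _).trans (hvd u hu))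
    have h3 : (J.card : ℝ) * (d * ((t - s) / ρ)) < t - s := by
      rcases le_or_gt d 0 with hd0 | hd0
      · refine lt_of_le_of_lt ?_ (sub_pos.2 hst)
        refine mul_nonpos_of_nonneg_of_nonpos (Nat.cast_nonneg _)
          (mul_nonpos_of_nonpos_of_nonneg hd0 ?_)
        exact div_nonneg (sub_pos.2 hst).le hρ.le
      · have : (J.card : ℝ) * (d * ((t - s) / ρ)) = (J.card * d / ρ) * (t - s) := by ring
        rw [this]
        refine mul_lt_of_lt_one_left (sub_pos.2 hst) ?_
        rw [div_lt_one hρ]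
        linarith
    have h4 := (abs_le.1 h1).1
    simp only [hg]
    linarith
  have hcont : Continuous g := by
    simp only [hg, hh]
    fun_prop
  have hg0 : g 0 = 0 := by
    simp only [hg, zero_add]
    refine Finset.sum_eq_zero fun u hu => ?_
    have := hoff 0 (by simp) u hu (fun h => hJ (h ▸ hu))
    rw [Set.Icc.coe_zero] at this
    rw [this, mul_zero]
  have hg1 : g 1 = 1 := by
    simp only [hg, add_eq_left]
    refine Finset.sum_eq_zero fun u hu => ?_
    by_cases hu1 : u = 1
    · rw [hv1 u hu hu1, hu1, sub_self, zero_mul]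
    · have := hoff 1 (by simp) u hu (Ne.symm hu1)
      rw [Set.Icc.coe_one] at this
      rw [this, mul_zero]
  have hmem : ∀ t : unitInterval, g t ∈ unitInterval := fun t =>
    ⟨hg0 ▸ hmono.monotone t.2.1, hg1 ▸ hmono.monotone t.2.2⟩
  let f : unitInterval → unitInterval := fun t => ⟨g t, hmem t⟩
  have hfm : StrictMono f := fun s t hst => hmono hst
  have hfs : Function.Surjective f := fun t =>
    mem_range_of_exists_le_of_exists_ge (by fun_prop)
      ⟨0, Subtype.coe_le_coe.1 (by simpa [f, hg0] using t.2.1)⟩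
      ⟨1, Subtype.coe_le_coe.1 (by simpa [f, hg1] using t.2.2)⟩
  refine ⟨hfm.orderIsoOfSurjective f hfs, fun u hu => Subtype.ext ?_, fun t => hgd t⟩
  change g u = v u
  simp only [hg]
  rw [Finset.sum_eq_single_of_mem u hu, hself, mul_one, add_sub_cancel]
  intro w hw hwu
  rw [hoff u (by simp [hu]) w hw (Ne.symm hwu), mul_zero]

lemma centeredWalk_apply (n : ℕ) (z : ℕ → ℝ) (m : ℝ) (t : unitInterval) :
    centeredWalk n z m t = (1 / (n : ℝ)) * ∑ i ∈ Finset.range ⌊(n : ℝ) * t⌋₊, (z i - m) := rfl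

lemma floor_mul_le (n : ℕ) (t : unitInterval) : ⌊(n : ℝ) * t⌋₊ ≤ n := by
  have : (n : ℝ) * t ≤ n := mul_le_of_le_one_right (Nat.cast_nonneg n) t.2.2
  exact_mod_cast (Nat.floor_mono this).trans (Nat.floor_natCast n).le

/-- The path depends only on the first `n` increments, and does so in a 1-Lipschitz way from the sup
norm to `J₁`. Borel measurability of the walk follows without describing the σ-algebra by
evaluations. -/
lemma continuous_centeredWalk (n : ℕ) (m : ℝ) :
    Continuous fun z : Fin n → ℝ =>
      centeredWalk n (fun i => if h : i < n then z ⟨i, h⟩ else 0) m := by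
  refine LipschitzWith.continuous (K := 1) (LipschitzWith.of_edist_le fun z w => ?_)
  rw [edist_dist z w]
  refine edist_le_of_forall fun t => ?_
  rw [centeredWalk_apply, centeredWalk_apply, ← mul_sub, ← Finset.sum_sub_distrib, abs_mul,
    abs_of_nonneg (by positivity)]
  have h1 : |∑ i ∈ Finset.range ⌊(n : ℝ) * t⌋₊, (((if h : i < n then z ⟨i, h⟩ else 0) - m) -
      ((if h : i < n then w ⟨i, h⟩ else 0) - m))| ≤ n * dist z w := by
    refine (Finset.abs_sum_le_sum_abs _ _).trans ?_
    calc _ ≤ ∑ i ∈ Finset.range ⌊(n : ℝ) * t⌋₊, dist z w := by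
            refine Finset.sum_le_sum fun i hi => ?_
            have hi' : i < n := (Finset.mem_range.1 hi).trans_le (floor_mul_le n t)
            rw [dif_pos hi', dif_pos hi', sub_sub_sub_cancel_right, ← Real.dist_eq]
            exact dist_le_pi_dist z w ⟨i, hi'⟩
      _ ≤ n * dist z w := by
            rw [Finset.sum_const, Finset.card_range, nsmul_eq_mul]
            gcongr
            exact floor_mul_le n t
  rcases Nat.eq_zero_or_pos n with rfl | hn
  · simp
  have hn' : (0 : ℝ) < n := by exact_mod_cast hn
  calc _ ≤ 1 / (n : ℝ) * (n * dist z w) := by gcongr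
    _ = dist z w := by field_simp

lemma centeredWalk_congr {n : ℕ} {z w : ℕ → ℝ} (m : ℝ) (h : ∀ i < n, z i = w i) :
    centeredWalk n z m = centeredWalk n w m := by
  have : (centeredWalk n z m).toFun = (centeredWalk n w m).toFun := by
    funext t
    rw [centeredWalk_apply, centeredWalk_apply]
    congr 1
    refine Finset.sum_congr rfl fun i hi => ?_
    rw [h i ((Finset.mem_range.1 hi).trans_le (floor_mul_le n t))]
  cases h1 : centeredWalk n z m
  cases h2 : centeredWalk n w m
  simp_all

lemma measurable_centeredWalk {Ω : Type*} [MeasurableSpace Ω] {Z : ℕ → Ω → ℝ}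
    (hZ : ∀ i, Measurable (Z i)) (n : ℕ) (m : ℝ) :
    Measurable fun ω => centeredWalk n (fun i => Z i ω) m := by
  have h := (continuous_centeredWalk n m).measurable.comp
    (measurable_pi_lambda (fun ω (i : Fin n) => Z i ω) fun i => hZ i)
  convert! h using 2 with ω
  exact centeredWalk_congr m fun i hi => by simp [hi]

/-- The value at `t` is determined by how many nonzero increments have occurred, so the range has at
most one more element than there are such increments. -/
lemma jumpRate_centeredWalk_le {n : ℕ} {y : ℕ → ℝ} (hy : ∀ i, 0 ≤ y i) :
    jumpRate (centeredWalk n y 0) ≤ ((Finset.range n).filter fun i => y i ≠ 0).card := by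
  rw [jumpRate_le_iff]
  have happ : ∀ t, centeredWalk n y 0 t =
      (1 / (n : ℝ)) * ∑ i ∈ (Finset.range ⌊(n : ℝ) * t⌋₊).filter (fun i => y i ≠ 0), y i := by
    intro t
    rw [centeredWalk_apply, Finset.sum_filter_ne_zero]
    simp
  have hsub : ∀ s t : unitInterval, s ≤ t →
      (Finset.range ⌊(n : ℝ) * s⌋₊).filter (fun i => y i ≠ 0) ⊆
        (Finset.range ⌊(n : ℝ) * t⌋₊).filter (fun i => y i ≠ 0) := fun s t hst =>
    Finset.filter_subset_filter _ (Finset.range_mono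
      (Nat.floor_mono (mul_le_mul_of_nonneg_left hst (Nat.cast_nonneg n))))
  refine ⟨fun s t hst => ?_, ?_, ?_⟩
  · change centeredWalk n y 0 s ≤ centeredWalk n y 0 t
    rw [happ, happ]
    exact mul_le_mul_of_nonneg_left
      (Finset.sum_le_sum_of_subset_of_nonneg (hsub s t hst) fun i _ _ => hy i) (by positivity)
  · rw [happ]
    simp
  · refine encard_range_le_of_factors _
      (fun t => ((Finset.range ⌊(n : ℝ) * t⌋₊).filter fun i => y i ≠ 0).card) _
      (fun t => Finset.card_le_card
        (Finset.filter_subset_filter _ (Finset.range_mono (floor_mul_le n t)))) fun s t hst => ?_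
    rw [happ, happ]
    congr 2
    rcases le_total s t with h | h
    · exact Finset.eq_of_subset_of_card_le (hsub s t h) hst.ge
    · exact (Finset.eq_of_subset_of_card_le (hsub t s h) hst.le).symm

/-- If few increments exceed `n δ`, few exceed `b`, and the sums of the increments truncated at `b`
stay close to their mean, then the walk is close to a path with few jumps. -/
lemma exists_jumpRate_le_edist_le {n : ℕ} (hn : 0 < n) {z : ℕ → ℝ} {m δ b e : ℝ} {k M : ℕ}
    (hz : ∀ i < n, 0 ≤ z i) (hδ : 0 < δ) (he : 0 < e) (hb : b ≤ n * δ) (hM : M * δ ≤ e)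
    (hk : ((Finset.range n).filter fun i => n * δ < z i).card ≤ k)
    (hcM : ((Finset.range n).filter fun i => b < z i).card ≤ M)
    (hs : ∀ l ≤ n, |∑ i ∈ Finset.range l, ((if z i ≤ b then z i else 0) - m)| ≤ n * e) :
    ∃ ζ : CadlagPath, jumpRate ζ ≤ k ∧ edist (centeredWalk n z m) ζ ≤ ENNReal.ofReal (2 * e) := by
  have hn' : (0 : ℝ) < n := by exact_mod_cast hn
  have hnδ : 0 < n * δ := by positivity
  -- The approximant keeps only the big increments, without centring.
  refine ⟨centeredWalk n (fun i => if n * δ < z i then z i else 0) 0, ?_, ?_⟩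
  · refine (jumpRate_centeredWalk_le fun i => ?_).trans ?_
    · split_ifs with h
      · exact (hnδ.trans h).le
      · exact le_rfl
    · refine Nat.cast_le.2 ((Finset.card_le_card fun i hi => ?_).trans hk)
      simp only [Finset.mem_filter] at hi ⊢
      refine ⟨hi.1, ?_⟩
      by_contra h
      exact hi.2 (if_neg h)
  · refine edist_le_of_forall fun t => ?_
    rw [centeredWalk_apply, centeredWalk_apply, ← mul_sub, ← Finset.sum_sub_distrib, abs_mul,
      abs_of_nonneg (by positivity)]
    set l := ⌊(n : ℝ) * t⌋₊ with hl
    have hln : l ≤ n := floor_mul_le n t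
    -- The error consists of the centred truncated sum and the increments in `(b, nδ]`; there are at
    -- most `M` of the latter, adding at most `M n δ ≤ n e`.
    have hsplit : ∑ i ∈ Finset.range l, ((z i - m) - ((if n * δ < z i then z i else 0) - 0)) =
        ∑ i ∈ Finset.range l, ((if z i ≤ b then z i else 0) - m) +
          ∑ i ∈ Finset.range l, if b < z i ∧ z i ≤ n * δ then z i else 0 := by
      rw [← Finset.sum_add_distrib]
      refine Finset.sum_congr rfl fun i _ => ?_
      rcases le_or_gt (z i) b with h1 | h1
      · have h2 := h1.trans hb
        simp [h1, h1.not_gt, h2.not_gt]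
      · rcases le_or_gt (z i) (n * δ) with h2 | h2
        · simp [h1, h1.not_ge, h2.not_gt, h2]
          ring
        · simp [h1.not_ge, h2, h2.not_ge]
    have hmid : |∑ i ∈ Finset.range l, if b < z i ∧ z i ≤ n * δ then z i else 0| ≤ n * e := by
      rw [← Finset.sum_filter]
      refine (Finset.abs_sum_le_sum_abs _ _).trans ((Finset.sum_le_card_nsmul _ _ (n * δ)
        fun i hi => ?_).trans ?_)
      · simp only [Finset.mem_filter, Finset.mem_range] at hi
        rw [abs_of_nonneg (hz i (hi.1.trans_le hln))]
        exact hi.2.2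
      · rw [nsmul_eq_mul]
        have hc : ((Finset.range l).filter fun i => b < z i ∧ z i ≤ n * δ).card ≤ M := by
          refine (Finset.card_le_card fun i hi => ?_).trans hcM
          simp only [Finset.mem_filter, Finset.mem_range] at hi ⊢
          exact ⟨hi.1.trans_le hln, hi.2.1⟩
        calc _ ≤ (M : ℝ) * (n * δ) := by gcongr
          _ = n * (M * δ) := by ring
          _ ≤ n * e := by gcongr
    rw [hsplit]
    calc _ ≤ 1 / (n : ℝ) * (n * e + n * e) := by
            gcongr
            exact (abs_add_le _ _).trans (add_le_add (hs l hln) hmid)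
      _ = 2 * e := by field_simp; ring

/-- If the increments at the indices `⌈n u⌉`, `u ∈ J`, are close to `n` times the jumps of `ξ`, and
the sums of the other increments stay small, then the walk is close to `ξ` after a time change
sending each `u ∈ J` to `⌈n u⌉ / n`. -/
lemma edist_centeredWalk_le {n : ℕ} (hn : 0 < n) {z : ℕ → ℝ} {m e d : ℝ} {ξ : CadlagPath}
    {J : Finset unitInterval} (hJ : 0 ∉ J) (hξ : ∀ t, ξ t = ξ.jumpSum J t)
    (lam : unitInterval ≃o unitInterval) (hlam : ∀ u ∈ J, (lam u : ℝ) = ⌈(n : ℝ) * u⌉₊ / n)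
    (hd : ∀ t, |(lam t : ℝ) - t| ≤ d) (he : 0 ≤ e)
    (hz : ∀ u ∈ J, |z (⌈(n : ℝ) * u⌉₊ - 1) / n - (ξ u - ξ.leftLimit u)| ≤ e)
    (hs : ∀ l ≤ n, |∑ i ∈ Finset.range l \ J.image (fun u : unitInterval => ⌈(n : ℝ) * u⌉₊ - 1), (z i - m)| ≤
      n * e) :
    edist (centeredWalk n z m) ξ ≤
      ENNReal.ofReal (max d (e + J.card * e + J.card * |m| / n)) := by
  classical
  have hn' : (0 : ℝ) < n := by exact_mod_cast hn
  refine edist_le_of_timeChange lam (fun t => (hd t).trans (le_max_left _ _)) fun t =>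
    le_trans ?_ (le_max_right _ _)
  -- Increments are indexed from `0`: the one with index `k` enters when `⌊n t⌋` reaches `k + 1`.
  -- The natural subtraction is harmless because `u ≠ 0`.
  set κ : unitInterval → ℕ := fun u => ⌈(n : ℝ) * u⌉₊ - 1 with hκ
  have hceil : ∀ u ∈ J, 0 < ⌈(n : ℝ) * u⌉₊ := fun u hu => Nat.ceil_pos.2
    (mul_pos hn' (unitInterval.pos_iff_ne_zero.2 fun h => hJ (h ▸ hu)))
  have hinj : Set.InjOn κ J := by
    intro u hu w hw huw
    have h1 := hceil u hu
    have h2 := hceil w hw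
    have h3 : ⌈(n : ℝ) * u⌉₊ = ⌈(n : ℝ) * w⌉₊ := by simp only [hκ] at huw; omega
    refine lam.injective (Subtype.ext ?_)
    rw [hlam u hu, hlam w hw, h3]
  set l := ⌊(n : ℝ) * lam t⌋₊ with hl
  have hln : l ≤ n := floor_mul_le n (lam t)
  -- Because `lam u = ⌈n u⌉ / n` and `lam` is increasing, the increment belonging to `u` has entered
  -- at time `lam t` exactly when `ξ` has jumped at `u` by time `t`.
  have hlt : ∀ u ∈ J, (κ u < l ↔ u ≤ t) := by
    intro u hu
    have h1 := hceil u hu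
    have h2 : κ u < l ↔ ⌈(n : ℝ) * u⌉₊ ≤ l := by simp only [hκ]; omega
    rw [h2, hl, Nat.le_floor_iff (mul_nonneg hn'.le (lam t).2.1), ← lam.le_iff_le,
      ← Subtype.coe_le_coe, hlam u hu, div_le_iff₀ hn', mul_comm (lam t : ℝ)]
  have hsum : ∑ i ∈ Finset.range l, (z i - m) =
      ∑ i ∈ Finset.range l \ J.image κ, (z i - m) + ∑ u ∈ J, if u ≤ t then z (κ u) - m else 0 := by
    rw [← Finset.sum_filter, ← Finset.sum_inter_add_sum_sdiff (Finset.range l) (J.image κ),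
      add_comm]
    congr 1
    have h1 : Finset.range l ∩ J.image κ = (J.filter (· ≤ t)).image κ := by
      ext i
      simp only [Finset.mem_inter, Finset.mem_range, Finset.mem_image, Finset.mem_filter]
      constructor
      · rintro ⟨hi, u, hu, rfl⟩
        exact ⟨u, ⟨hu, (hlt u hu).1 hi⟩, rfl⟩
      · rintro ⟨u, ⟨hu, hut⟩, rfl⟩
        exact ⟨(hlt u hu).2 hut, u, hu, rfl⟩
    rw [h1, Finset.sum_image]
    exact hinj.mono fun u hu => (Finset.mem_filter.1 hu).1
  have hdiff : centeredWalk n z m (lam t) - ξ t =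
      1 / (n : ℝ) * ∑ i ∈ Finset.range l \ J.image κ, (z i - m) +
        ∑ u ∈ J, if u ≤ t then (z (κ u) / n - (ξ u - ξ.leftLimit u)) - m / n else 0 := by
    rw [centeredWalk_apply, hsum, hξ t, jumpSum, mul_add, add_sub_assoc]
    congr 1
    rw [Finset.mul_sum, ← Finset.sum_sub_distrib]
    refine Finset.sum_congr rfl fun u _ => ?_
    split_ifs
    · ring
    · ring
  rw [hdiff]
  refine (abs_add_le _ _).trans ?_
  rw [add_assoc]
  refine add_le_add ?_ ?_
  · rw [abs_mul, abs_of_nonneg (by positivity)]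
    calc _ ≤ 1 / (n : ℝ) * (n * e) := by gcongr; exact hs l hln
      _ = e := by field_simp
  · rw [mul_div_assoc, ← mul_add, ← nsmul_eq_mul, ← Finset.sum_const]
    refine (Finset.abs_sum_le_sum_abs _ _).trans (Finset.sum_le_sum fun u hu => ?_)
    split_ifs
    · refine (abs_sub _ _).trans (add_le_add (hz u hu) ?_)
      rw [abs_div, abs_of_pos hn']
    · rw [abs_zero]
      positivity

end CadlagPath

/-! ### Growth of monotone regularly varying functions. -/

/-- Halve `y` until it falls in `[y₀, 2y₀]`; halving never decreases `g`. -/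
lemma le_of_forall_two_mul_le {g : ℝ → ℝ} {y₀ C : ℝ} (hy₀ : 0 < y₀)
    (hg : ∀ y, y₀ ≤ y → g (2 * y) ≤ g y) (hC : ∀ y, y₀ ≤ y → y ≤ 2 * y₀ → g y ≤ C)
    {y : ℝ} (hy : y₀ ≤ y) : g y ≤ C := by
  have key : ∀ k : ℕ, ∀ y, y₀ ≤ y → y ≤ 2 ^ k * y₀ → g y ≤ C := by
    intro k
    induction k with
    | zero => exact fun y h1 h2 => hC y h1 (by linarith)
    | succ k ih =>
      intro y h1 h2
      rcases le_total y (2 * y₀) with h | h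
      · exact hC y h1 h
      · have h3 := hg (y / 2) (by linarith)
        rw [mul_div_cancel₀ y two_ne_zero] at h3
        exact h3.trans (ih (y / 2) (by linarith) (by rw [pow_succ] at h2; linarith))
  obtain ⟨k, hk⟩ := pow_unbounded_of_one_lt (y / y₀) one_lt_two
  exact key k y hy (by rw [div_lt_iff₀ hy₀] at hk; exact hk.le)

namespace IsRegularlyVarying

variable {r : ℝ → ℝ} {γ : ℝ}

lemma eventually_pos (hr : IsRegularlyVarying r γ) : ∀ᶠ y in atTop, 0 < r y := by
  obtain ⟨⟨A, hA, -⟩, -⟩ := hr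
  filter_upwards [eventually_ge_atTop A] with y hy using hA y hy

/-- As `r(2y)/r(y) → 2^γ < 2^p`, the quotient `r(y)/y^p` does not increase under doubling, and
monotonicity bounds it on one dyadic block. -/
lemma exists_eventually_le_rpow (hr : IsRegularlyVarying r γ) {B : ℝ}
    (hB : MonotoneOn r (Set.Ici B)) {p : ℝ} (hp : γ < p) :
    ∃ C > 0, ∀ᶠ y in atTop, r y ≤ C * y ^ p := by
  have h1 : ∀ᶠ y in atTop, r (2 * y) / r y < 2 ^ p :=
    (hr.2 2 two_pos).eventually (gt_mem_nhds (Real.rpow_lt_rpow_of_exponent_lt one_lt_two hp))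
  obtain ⟨y₀, h⟩ := eventually_atTop.1
    (((h1.and hr.eventually_pos).and (eventually_ge_atTop B)).and (eventually_gt_atTop 0))
  have hy₀ : 0 < y₀ := (h y₀ le_rfl).2
  have hpos : 0 < r (2 * y₀) := (h (2 * y₀) (by linarith)).1.1.2
  -- The sign of `p` is free, so `y ^ p` may be smallest at either end of the block.
  refine ⟨r (2 * y₀) / (min (y₀ ^ p) ((2 * y₀) ^ p)),
    div_pos hpos (lt_min (by positivity) (by positivity)), ?_⟩
  filter_upwards [eventually_ge_atTop y₀] with y hy
  have hyp : 0 < y := hy₀.trans_le hy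
  rw [← div_le_iff₀ (by positivity)]
  refine le_of_forall_two_mul_le (g := fun y => r y / y ^ p) hy₀ (fun y hy => ?_)
    (fun y hy hy2 => ?_) hy
  · obtain ⟨⟨⟨h1, h2⟩, -⟩, h4⟩ := h y hy
    rw [div_lt_iff₀ h2] at h1
    rw [Real.mul_rpow two_pos.le h4.le, div_le_div_iff₀ (by positivity) (by positivity)]
    have : 0 < y ^ p := by positivity
    nlinarith
  · obtain ⟨⟨⟨-, h2⟩, h3⟩, h4⟩ := h y hy
    refine div_le_div₀ hpos.le (hB h3 (h (2 * y₀) (by linarith)).1.2 hy2)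
      (lt_min (by positivity) (by positivity)) ?_
    rcases le_total 0 p with hp0 | hp0
    · exact (min_le_left _ _).trans (Real.rpow_le_rpow hy₀.le hy hp0)
    · exact (min_le_right _ _).trans (Real.rpow_le_rpow_of_nonpos h4 hy2 hp0)

lemma exists_eventually_rpow_le (hr : IsRegularlyVarying r γ) {B : ℝ}
    (hB : MonotoneOn r (Set.Ici B)) {p : ℝ} (hp0 : 0 ≤ p) (hp : p < γ) :
    ∃ c > 0, ∀ᶠ y in atTop, c * y ^ p ≤ r y := by
  have h1 : ∀ᶠ y in atTop, 2 ^ p < r (2 * y) / r y :=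
    (hr.2 2 two_pos).eventually (lt_mem_nhds (Real.rpow_lt_rpow_of_exponent_lt one_lt_two hp))
  obtain ⟨y₀, h⟩ := eventually_atTop.1
    (((h1.and hr.eventually_pos).and (eventually_ge_atTop B)).and (eventually_gt_atTop 0))
  have hy₀ : 0 < y₀ := (h y₀ le_rfl).2
  have hpos : 0 < r y₀ := (h y₀ le_rfl).1.1.2
  refine ⟨((2 * y₀) ^ p / r y₀)⁻¹, inv_pos.2 (div_pos (by positivity) hpos), ?_⟩
  filter_upwards [eventually_ge_atTop y₀] with y hy
  have hr0 : 0 < r y := (h y hy).1.1.2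
  rw [inv_mul_le_iff₀ (div_pos (by positivity) hpos), ← div_le_iff₀ hr0]
  refine le_of_forall_two_mul_le (g := fun y => y ^ p / r y) hy₀ (fun y hy => ?_)
    (fun y hy hy2 => ?_) hy
  · obtain ⟨⟨⟨h1, h2⟩, -⟩, h4⟩ := h y hy
    have h5 := (h (2 * y) (by linarith)).1.1.2
    rw [lt_div_iff₀ h2] at h1
    rw [Real.mul_rpow two_pos.le h4.le, div_le_div_iff₀ h5 h2]
    have : 0 < y ^ p := by positivity
    nlinarith
  · obtain ⟨⟨⟨-, h2⟩, h3⟩, h4⟩ := h y hy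
    exact div_le_div₀ (by positivity) (Real.rpow_le_rpow h4.le hy2 hp0) hpos
      (hB (h y₀ le_rfl).1.2 h3 hy)

lemma tendsto_atTop (hr : IsRegularlyVarying r γ) {B : ℝ} (hB : MonotoneOn r (Set.Ici B))
    (hγ : 0 < γ) : Tendsto r atTop atTop := by
  obtain ⟨c, hc, h⟩ := hr.exists_eventually_rpow_le hB (half_pos hγ).le (half_lt_self hγ)
  exact tendsto_atTop_mono' _ h ((tendsto_rpow_atTop (half_pos hγ)).const_mul_atTop hc)

/-- With `y = log n`, this makes polynomial factors in `n` negligible at speed `r(log n)`; here `γ >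
1` is essential. -/
lemma tendsto_id_div (hr : IsRegularlyVarying r γ) {B : ℝ} (hB : MonotoneOn r (Set.Ici B))
    (hγ : 1 < γ) : Tendsto (fun y => y / r y) atTop (𝓝 0) := by
  obtain ⟨p, hp1, hp2⟩ := exists_between hγ
  obtain ⟨c, hc, h⟩ := hr.exists_eventually_rpow_le hB (by linarith) hp2
  have h0 : Tendsto (fun y : ℝ => c⁻¹ * y ^ (-(p - 1))) atTop (𝓝 0) := by
    simpa using (tendsto_rpow_neg_atTop (sub_pos.2 hp1)).const_mul c⁻¹
  refine tendsto_of_tendsto_of_tendsto_of_le_of_le' tendsto_const_nhds h0 ?_ ?_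
  · filter_upwards [hr.eventually_pos, eventually_gt_atTop 0] with y h1 h2
    positivity
  · filter_upwards [h, hr.eventually_pos, eventually_gt_atTop 0] with y h1 h2 h3
    have h4 : y ^ p = y ^ (p - 1) * y := by
      rw [← Real.rpow_add_one h3.ne', sub_add_cancel]
    have h5 : 0 < y ^ (p - 1) := by positivity
    rw [div_le_iff₀ h2, Real.rpow_neg h3.le]
    rw [h4] at h1
    calc y = c⁻¹ * (y ^ (p - 1))⁻¹ * (c * (y ^ (p - 1) * y)) := by field_simp
      _ ≤ _ := by gcongr

lemma tendsto_div_exp (hr : IsRegularlyVarying r γ) {B : ℝ} (hB : MonotoneOn r (Set.Ici B))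
    {b : ℝ} (hb : 0 < b) : Tendsto (fun y => r y / Real.exp (b * y)) atTop (𝓝 0) := by
  obtain ⟨C, hC, h⟩ := hr.exists_eventually_le_rpow hB (lt_add_one γ)
  have h0 : Tendsto (fun y : ℝ => C * (y ^ (γ + 1) / Real.exp (b * y))) atTop (𝓝 0) := by
    simpa using (isLittleO_rpow_exp_pos_mul_atTop (γ + 1) hb).tendsto_div_nhds_zero.const_mul C
  refine tendsto_of_tendsto_of_tendsto_of_le_of_le' tendsto_const_nhds h0 ?_ ?_
  · filter_upwards [hr.eventually_pos] with y h1
    positivity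
  · filter_upwards [h] with y h1
    rw [← mul_div_assoc]
    gcongr

/-- Eventually `y + b` is bounded by `(1 + δ) y`, from below for `δ < 0` and from above for `δ > 0`;
monotonicity of `r` and continuity of `(1 + δ)^γ` at `δ = 0` finish. -/
lemma tendsto_add_const_div (hr : IsRegularlyVarying r γ) {B : ℝ} (hB : MonotoneOn r (Set.Ici B))
    (b : ℝ) : Tendsto (fun y => r (y + b) / r y) atTop (𝓝 1) := by
  have hcont : Tendsto (fun δ : ℝ => (1 + δ) ^ γ) (𝓝 0) (𝓝 1) := by
    have : ContinuousAt (fun δ : ℝ => (1 + δ) ^ γ) 0 :=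
      (by fun_prop : ContinuousAt (fun δ : ℝ => 1 + δ) 0).rpow_const (by simp)
    simpa [ContinuousAt] using this
  refine tendsto_order.2 ⟨fun a ha => ?_, fun a ha => ?_⟩
  · have h1 : ∀ᶠ δ in 𝓝[<] (0 : ℝ), a < (1 + δ) ^ γ :=
      nhdsWithin_le_nhds (hcont.eventually (lt_mem_nhds ha))
    obtain ⟨δ, hδa, hδ1, hδ0⟩ := (h1.and (Ioo_mem_nhdsLT (show (-1 : ℝ) < 0 by norm_num))).exists
    have hlin : ∀ᶠ y : ℝ in atTop, (1 + δ) * y ≤ y + b := by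
      filter_upwards [eventually_ge_atTop (-b / -δ)] with y hy
      rw [div_le_iff₀ (by linarith)] at hy
      linarith
    filter_upwards [(hr.2 (1 + δ) (by linarith)).eventually (lt_mem_nhds hδa), hlin,
      hr.eventually_pos,
      (tendsto_id.const_mul_atTop (by linarith : 0 < 1 + δ)).eventually_ge_atTop B]
      with y h2 h3 h4 h5
    refine h2.trans_le ?_
    gcongr
    exact hB h5 (le_trans (α := ℝ) h5 h3) h3
  · have h1 : ∀ᶠ δ in 𝓝[>] (0 : ℝ), (1 + δ) ^ γ < a :=
      nhdsWithin_le_nhds (hcont.eventually (gt_mem_nhds ha))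
    obtain ⟨δ, hδa, hδ0⟩ := (h1.and self_mem_nhdsWithin).exists
    have hδ0 : 0 < δ := hδ0
    have hlin : ∀ᶠ y : ℝ in atTop, y + b ≤ (1 + δ) * y := by
      filter_upwards [eventually_ge_atTop (b / δ)] with y hy
      rw [div_le_iff₀ hδ0] at hy
      linarith
    filter_upwards [(hr.2 (1 + δ) (by linarith)).eventually (gt_mem_nhds hδa), hlin,
      hr.eventually_pos, eventually_ge_atTop (B - b)] with y h2 h3 h4 h5
    refine lt_of_le_of_lt ?_ h2
    have h5' : B ≤ y + b := by linarith
    gcongr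
    exact hB h5' (le_trans (α := ℝ) h5' h3) h3

end IsRegularlyVarying

/-! ### Exponential bounds at a given speed. -/

lemma tendsto_log_natCast_atTop : Tendsto (fun n : ℕ => Real.log n) atTop atTop :=
  Real.tendsto_log_atTop.comp tendsto_natCast_atTop_atTop

/-- `p n ≤ exp (-(c - η) a n)` eventually, for every `η > 0`. -/
def ExpUpperBound (p : ℕ → ℝ≥0∞) (a : ℕ → ℝ) (c : ℝ) : Prop :=
  ∀ η > 0, ∀ᶠ n in atTop, p n ≤ ENNReal.ofReal (Real.exp (-(c - η) * a n))

namespace ExpUpperBound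

variable {p q : ℕ → ℝ≥0∞} {a : ℕ → ℝ} {c : ℝ}

lemma mono (hp : ExpUpperBound p a c) (h : ∀ᶠ n in atTop, q n ≤ p n) : ExpUpperBound q a c := by
  intro η hη
  filter_upwards [hp η hη, h] with n h1 h2 using h2.trans h1

lemma anti (ha : Tendsto a atTop atTop) {c' : ℝ} (hp : ExpUpperBound p a c) (h : c' ≤ c) :
    ExpUpperBound p a c' := by
  intro η hη
  filter_upwards [hp η hη, ha.eventually_ge_atTop 0] with n h1 h2
  refine h1.trans (ENNReal.ofReal_le_ofReal (Real.exp_le_exp.2 ?_))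
  exact mul_le_mul_of_nonneg_right (by linarith) h2

lemma eventually_le (ha : Tendsto a atTop atTop) (hc : 0 < c) (hp : ExpUpperBound p a c) {δ : ℝ}
    (hδ : 0 < δ) : ∀ᶠ n in atTop, p n ≤ ENNReal.ofReal δ := by
  filter_upwards [hp (c / 2) (half_pos hc),
    (ha.const_mul_atTop (half_pos hc)).eventually_ge_atTop (-Real.log δ)] with n h1 h2
  refine h1.trans (ENNReal.ofReal_le_ofReal ?_)
  rw [← Real.exp_log hδ]
  exact Real.exp_le_exp.2 (by linarith)

lemma add (ha : Tendsto a atTop atTop) (hp : ExpUpperBound p a c) (hq : ExpUpperBound q a c) :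
    ExpUpperBound (fun n => p n + q n) a c := by
  intro η hη
  filter_upwards [hp (η / 2) (half_pos hη), hq (η / 2) (half_pos hη),
    (ha.const_mul_atTop (half_pos hη)).eventually_ge_atTop (Real.log 2)] with n h1 h2 h3
  refine (add_le_add h1 h2).trans ?_
  rw [← ENNReal.ofReal_add (Real.exp_pos _).le (Real.exp_pos _).le, ← two_mul]
  refine ENNReal.ofReal_le_ofReal ?_
  rw [← Real.exp_log two_pos, ← Real.exp_add, Real.exp_log two_pos]
  exact Real.exp_le_exp.2 (by linarith)

lemma limsup_le (ha : Tendsto a atTop atTop) (hp : ExpUpperBound p a c) :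
    limsup (fun n => ENNReal.log (p n) / (a n : EReal)) atTop ≤ ((-c : ℝ) : EReal) := by
  refine EReal.le_of_forall_lt_iff_le.1 fun z hz => ?_
  have hz' : -c < z := by exact_mod_cast hz
  refine limsup_le_of_le (h := ?_)
  filter_upwards [hp (z + c) (by linarith), ha.eventually_gt_atTop 0] with n h1 h2
  rw [EReal.div_le_iff_le_mul (by exact_mod_cast h2) (EReal.coe_ne_top _)]
  have h3 := ENNReal.log_le_log h1
  rw [ENNReal.log_ofReal_of_pos (Real.exp_pos _), Real.log_exp] at h3
  refine h3.trans (le_of_eq ?_)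
  rw [← EReal.coe_mul]
  congr 1
  ring

end ExpUpperBound

lemma expUpperBound_exp {f a : ℕ → ℝ} {c : ℝ} (ha : Tendsto a atTop atTop)
    (h : ∀ z, -c < z → ∀ᶠ n in atTop, f n / a n ≤ z) :
    ExpUpperBound (fun n => ENNReal.ofReal (Real.exp (f n))) a c := by
  intro η hη
  filter_upwards [h (-(c - η)) (by linarith), ha.eventually_gt_atTop 0] with n h1 h2
  rw [div_le_iff₀ h2] at h1
  exact ENNReal.ofReal_le_ofReal (Real.exp_le_exp.2 h1)

lemma le_liminf_log_div {p : ℕ → ℝ≥0∞} {f a : ℕ → ℝ} {c : ℝ} (ha : Tendsto a atTop atTop)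
    (hp : ∀ᶠ n in atTop, ENNReal.ofReal (Real.exp (f n)) ≤ p n)
    (hf : Tendsto (fun n => f n / a n) atTop (𝓝 (-c))) :
    ((-c : ℝ) : EReal) ≤ liminf (fun n => ENNReal.log (p n) / (a n : EReal)) atTop := by
  refine EReal.ge_of_forall_gt_iff_ge.1 fun z hz => ?_
  have hz' : z < -c := by exact_mod_cast hz
  refine le_liminf_of_le (h := ?_)
  filter_upwards [hp, hf.eventually (lt_mem_nhds hz'), ha.eventually_gt_atTop 0] with n h1 h2 h3
  rw [EReal.le_div_iff_mul_le (by exact_mod_cast h3) (EReal.coe_ne_top _)]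
  have h4 := ENNReal.log_le_log h1
  rw [ENNReal.log_ofReal_of_pos (Real.exp_pos _), Real.log_exp] at h4
  refine le_trans ?_ h4
  rw [lt_div_iff₀ h3] at h2
  exact_mod_cast h2.le

/-! ### Tail law, truncation and exceedance counts. -/

lemma monotoneOn_of_tail {Ω : Type*} [MeasurableSpace Ω] {P : Measure Ω} {X : Ω → ℝ} {r : ℝ → ℝ}
    (h : ∀ᶠ x : ℝ in atTop, P {ω | x < X ω} = ENNReal.ofReal (Real.exp (-r (Real.log x)))) :
    ∃ B, MonotoneOn r (Set.Ici B) := by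
  obtain ⟨B, hB⟩ := eventually_atTop.1 (Real.tendsto_exp_atTop.eventually h)
  refine ⟨B, fun x hx y hy hxy => ?_⟩
  have h1 : P {ω | Real.exp y < X ω} ≤ P {ω | Real.exp x < X ω} :=
    measure_mono fun ω hω => (Real.exp_le_exp.2 hxy).trans_lt hω
  rw [hB x hx, hB y hy, Real.log_exp, Real.log_exp,
    ENNReal.ofReal_le_ofReal_iff (Real.exp_pos _).le, Real.exp_le_exp] at h1
  linarith

/-- Eventually `r(y) ≥ 2y`, so the tail is dominated by `x^(-2)`. -/
lemma integrable_of_tail {Ω : Type*} [MeasurableSpace Ω] {P : Measure Ω} [IsProbabilityMeasure P]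
    {X : Ω → ℝ} (hX : Measurable X) (hX0 : ∀ᵐ ω ∂P, 0 ≤ X ω) {r : ℝ → ℝ} {γ : ℝ} (hγ : 1 < γ)
    (hr : IsRegularlyVarying r γ)
    (h : ∀ᶠ x : ℝ in atTop, P {ω | x < X ω} = ENNReal.ofReal (Real.exp (-r (Real.log x)))) :
    Integrable X P := by
  obtain ⟨B, hB⟩ := monotoneOn_of_tail h
  have h1 : ∀ᶠ y in atTop, 2 * y ≤ r y := by
    filter_upwards [(hr.tendsto_id_div hB hγ).eventually (gt_mem_nhds (half_pos one_pos)),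
      hr.eventually_pos] with y h1 h2
    rw [div_lt_iff₀ h2] at h1
    linarith
  obtain ⟨x₀, hx₀⟩ := eventually_atTop.1
    ((h.and (Real.tendsto_log_atTop.eventually h1)).and (eventually_gt_atTop 0))
  have hx₀0 : 0 < x₀ := (hx₀ x₀ le_rfl).2
  refine ⟨hX.aestronglyMeasurable, (hasFiniteIntegral_iff_ofReal hX0).2 ?_⟩
  rw [lintegral_eq_lintegral_meas_lt P hX0 hX.aemeasurable, ← Set.Ioc_union_Ioi_eq_Ioi hx₀0.le]
  refine (lintegral_union_le _ _ _).trans_lt (ENNReal.add_lt_top.2 ⟨?_, ?_⟩)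
  · calc _ ≤ ∫⁻ _ in Set.Ioc 0 x₀, 1 := lintegral_mono fun _ => prob_le_one
      _ < ⊤ := by simp
  · refine lt_of_le_of_lt ?_ (integrableOn_Ioi_rpow_of_lt (by norm_num : (-2 : ℝ) < -1)
      hx₀0).setLIntegral_lt_top
    refine setLIntegral_mono' measurableSet_Ioi fun x hx => ?_
    obtain ⟨⟨h2, h3⟩, h4⟩ := hx₀ x (le_of_lt hx)
    rw [h2, Real.rpow_def_of_pos h4]
    exact ENNReal.ofReal_le_ofReal (Real.exp_le_exp.2 (by linarith))

/-- The value `x`, replaced by `0` when it exceeds `b`. -/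
noncomputable def truncAt (b x : ℝ) : ℝ := if x ≤ b then x else 0

lemma measurable_truncAt (b : ℝ) : Measurable (truncAt b) :=
  Measurable.ite measurableSet_Iic measurable_id measurable_const

lemma tendsto_integral_truncAt {Ω : Type*} [MeasurableSpace Ω] {P : Measure Ω} {X : Ω → ℝ}
    (hX : Integrable X P) :
    Tendsto (fun b => ∫ ω, truncAt b (X ω) ∂P) atTop (𝓝 (∫ ω, X ω ∂P)) := by
  refine tendsto_integral_filter_of_dominated_convergence (fun ω => ‖X ω‖)
    (Eventually.of_forall fun b =>
      ((measurable_truncAt b).comp_aemeasurable hX.aemeasurable).aestronglyMeasurable)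
    (Eventually.of_forall fun b => ae_of_all _ fun ω => ?_) hX.norm (ae_of_all _ fun ω => ?_)
  · rw [truncAt]
    split_ifs <;> simp
  · refine tendsto_const_nhds.congr' ?_
    filter_upwards [eventually_ge_atTop (X ω)] with b hb
    rw [truncAt, if_pos hb]

lemma measure_lt_eq_of_identDistrib {Ω : Type*} [MeasurableSpace Ω] {P : Measure Ω} {Z : ℕ → Ω → ℝ}
    (hid : ∀ i, IdentDistrib (Z i) (Z 0) P P) (i : ℕ) (x : ℝ) :
    P {ω | x < Z i ω} = P {ω | x < Z 0 ω} :=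
  (hid i).measure_mem_eq measurableSet_Ioi

/-- Union bound over the `m`-element index sets, of which there are at most `n^m`, with independence
inside each. -/
lemma measure_le_card_lt_le {Ω : Type*} [MeasurableSpace Ω] {P : Measure Ω} {Z : ℕ → Ω → ℝ}
    (hindep : iIndepFun Z P) (hid : ∀ i, IdentDistrib (Z i) (Z 0) P P)
    (n m : ℕ) (x : ℝ) :
    P {ω | m ≤ ((Finset.range n).filter fun i => x < Z i ω).card} ≤
      (n : ℝ≥0∞) ^ m * P {ω | x < Z 0 ω} ^ m := by
  have hsub : {ω | m ≤ ((Finset.range n).filter fun i => x < Z i ω).card} ⊆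
      ⋃ S ∈ (Finset.range n).powersetCard m, ⋂ i ∈ S, Z i ⁻¹' Set.Ioi x := by
    intro ω hω
    obtain ⟨S, hS, hc⟩ := Finset.exists_subset_card_eq hω
    refine Set.mem_biUnion (x := S)
      (Finset.mem_powersetCard.2 ⟨hS.trans (Finset.filter_subset _ _), hc⟩) ?_
    exact Set.mem_iInter₂.2 fun i hi => (Finset.mem_filter.1 (hS hi)).2
  refine (measure_mono hsub).trans ((measure_biUnion_finset_le _ _).trans ?_)
  calc _ = ∑ S ∈ (Finset.range n).powersetCard m, P {ω | x < Z 0 ω} ^ m := by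
          refine Finset.sum_congr rfl fun S hS => ?_
          rw [hindep.measure_inter_preimage_eq_mul S fun _ _ => measurableSet_Ioi,
            ← (Finset.mem_powersetCard.1 hS).2, ← Finset.prod_const]
          exact Finset.prod_congr rfl fun i _ => measure_lt_eq_of_identDistrib hid i x
    _ ≤ _ := by
          rw [Finset.sum_const, Finset.card_powersetCard, Finset.card_range, nsmul_eq_mul]
          gcongr
          exact_mod_cast Nat.choose_le_pow n m

/-! ### Hoeffding bounds for truncated sums. -/

section IID

variable {Ω : Type*} [MeasurableSpace Ω] {P : Measure Ω} [IsProbabilityMeasure P] {Z : ℕ → Ω → ℝ}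

/-- Truncated increments lie in `[0, b]`, so they are sub-Gaussian with parameter `(b/2)^2` after
centring; the inequality is applied to the sum and to its negative. -/
lemma measure_lt_abs_sum_truncAt_le (hm : ∀ i, Measurable (Z i)) (hindep : iIndepFun Z P)
    (hid : ∀ i, IdentDistrib (Z i) (Z 0) P P) (h0 : ∀ i, ∀ᵐ ω ∂P, 0 ≤ Z i ω) {b e : ℝ}
    (hb : 0 < b) (he : 0 ≤ e) {n : ℕ} (A : Finset ℕ) (hA : A.card ≤ n) :
    P {ω | e < |∑ i ∈ A, (truncAt b (Z i ω) - ∫ ω, truncAt b (Z 0 ω) ∂P)|} ≤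
      ENNReal.ofReal (2 * Real.exp (-(2 * e ^ 2 / (n * b ^ 2)))) := by
  set μ := ∫ ω, truncAt b (Z 0 ω) ∂P with hμ
  rcases A.eq_empty_or_nonempty with rfl | hne
  · simp [he.not_gt]
  have hA0 : (0 : ℝ) < A.card := by exact_mod_cast hne.card_pos
  have hindep' : iIndepFun (fun i ω => truncAt b (Z i ω) - μ) P :=
    hindep.comp (fun _ x => truncAt b x - μ) fun _ => (measurable_truncAt b).sub_const μ
  have hneg : iIndepFun (fun i ω => -(truncAt b (Z i ω) - μ)) P :=
    hindep'.comp (fun _ x => -x) fun _ => measurable_neg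
  have hsub : ∀ i, HasSubgaussianMGF (fun ω => truncAt b (Z i ω) - μ) ((‖b - 0‖₊ / 2) ^ 2) P := by
    intro i
    have h1 : ∫ ω, truncAt b (Z i ω) ∂P = μ := ((hid i).comp (measurable_truncAt b)).integral_eq
    rw [← h1]
    refine hasSubgaussianMGF_of_mem_Icc ((measurable_truncAt b).comp (hm i)).aemeasurable ?_
    filter_upwards [h0 i] with ω hω
    rw [truncAt]
    split_ifs with h
    · exact ⟨hω, h⟩
    · exact ⟨le_rfl, hb.le⟩
  have hexp : ∀ x : ℝ, x ≤ Real.exp (-e ^ 2 / (2 * ∑ i ∈ A, ((‖b - 0‖₊ / 2) ^ 2 : NNReal))) →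
      x ≤ Real.exp (-(2 * e ^ 2 / (n * b ^ 2))) := by
    refine fun x hx => hx.trans (Real.exp_le_exp.2 ?_)
    rw [Finset.sum_const, nsmul_eq_mul]
    push_cast
    rw [sub_zero, Real.norm_of_nonneg hb.le, neg_div, neg_le_neg_iff]
    have h2 : e ^ 2 / (2 * ((A.card : ℝ) * (b / 2) ^ 2)) = 2 * e ^ 2 / (A.card * b ^ 2) := by
      field_simp
    rw [h2]
    gcongr
  have hU := hexp _ (HasSubgaussianMGF.measure_sum_ge_le_of_iIndepFun hindep' (s := A) (fun i _ => hsub i) he)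
  have hL := hexp _ (HasSubgaussianMGF.measure_sum_ge_le_of_iIndepFun hneg (s := A) (fun i _ => (hsub i).neg) he)
  have hcov : {ω | e < |∑ i ∈ A, (truncAt b (Z i ω) - μ)|} ⊆
      {ω | e ≤ ∑ i ∈ A, (truncAt b (Z i ω) - μ)} ∪
        {ω | e ≤ ∑ i ∈ A, -(truncAt b (Z i ω) - μ)} := by
    intro ω hω
    rw [Set.mem_ofPred_eq] at hω
    rcases lt_abs.1 hω with h | h
    · exact Or.inl h.le
    · refine Or.inr ?_
      change e ≤ ∑ i ∈ A, -(truncAt b (Z i ω) - μ)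
      rw [Finset.sum_neg_distrib]
      exact h.le
  refine (measure_mono hcov).trans ((measure_union_le _ _).trans ?_)
  rw [two_mul, ENNReal.ofReal_add (Real.exp_pos _).le (Real.exp_pos _).le]
  refine add_le_add ?_ ?_
  · exact (ENNReal.le_ofReal_iff_toReal_le (measure_ne_top _ _) (Real.exp_pos _).le).2 hU
  · exact (ENNReal.le_ofReal_iff_toReal_le (measure_ne_top _ _) (Real.exp_pos _).le).2 hL

lemma measure_exists_lt_abs_sum_truncAt_le (hm : ∀ i, Measurable (Z i)) (hindep : iIndepFun Z P)
    (hid : ∀ i, IdentDistrib (Z i) (Z 0) P P) (h0 : ∀ i, ∀ᵐ ω ∂P, 0 ≤ Z i ω) {b e : ℝ}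
    (hb : 0 < b) (he : 0 ≤ e) (n : ℕ) (K : Finset ℕ) :
    P {ω | ∃ l ≤ n, e < |∑ i ∈ Finset.range l \ K,
        (truncAt b (Z i ω) - ∫ ω, truncAt b (Z 0 ω) ∂P)|} ≤
      (n + 1) * ENNReal.ofReal (2 * Real.exp (-(2 * e ^ 2 / (n * b ^ 2)))) := by
  have hsub : {ω | ∃ l ≤ n, e < |∑ i ∈ Finset.range l \ K,
        (truncAt b (Z i ω) - ∫ ω, truncAt b (Z 0 ω) ∂P)|} ⊆
      ⋃ l ∈ Finset.range (n + 1), {ω | e < |∑ i ∈ Finset.range l \ K,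
        (truncAt b (Z i ω) - ∫ ω, truncAt b (Z 0 ω) ∂P)|} := by
    rintro ω ⟨l, hl, h⟩
    exact Set.mem_biUnion (x := l) (by simpa using Nat.lt_succ_of_le hl) h
  refine (measure_mono hsub).trans ((measure_biUnion_finset_le _ _).trans ?_)
  refine (Finset.sum_le_card_nsmul _ _ _ fun l hl => measure_lt_abs_sum_truncAt_le hm hindep hid h0
    hb he (n := n) _ ?_).trans ?_
  · refine (Finset.card_le_card Finset.sdiff_subset).trans ?_
    rw [Finset.card_range]
    exact Nat.lt_succ_iff.1 (Finset.mem_range.1 hl)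
  · rw [Finset.card_range, nsmul_eq_mul]
    push_cast
    rfl

end IID

/-! ### Rates of the rare events. -/

section Asymptotics

variable {Ω : Type*} [MeasurableSpace Ω] {P : Measure Ω} {Z : ℕ → Ω → ℝ} {r : ℝ → ℝ} {γ B : ℝ}

/-- The logarithm of the union bound is `m (log n - r(log x_n))`, and `log n` is negligible. -/
lemma expUpperBound_card_lt (hindep : iIndepFun Z P) (hid : ∀ i, IdentDistrib (Z i) (Z 0) P P)
    (hγ : 1 < γ) (hr : IsRegularlyVarying r γ) (hB : MonotoneOn r (Set.Ici B))
    (htail : ∀ᶠ x : ℝ in atTop, P {ω | x < Z 0 ω} = ENNReal.ofReal (Real.exp (-r (Real.log x))))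
    {x : ℕ → ℝ} {ρ : ℝ} (hx : Tendsto x atTop atTop)
    (hxr : Tendsto (fun n => r (Real.log (x n)) / r (Real.log n)) atTop (𝓝 ρ)) (m : ℕ) :
    ExpUpperBound (fun n => P {ω | m ≤ ((Finset.range n).filter fun i => x n < Z i ω).card})
      (fun n => r (Real.log n)) (m * ρ) := by
  have ha : Tendsto (fun n : ℕ => r (Real.log n)) atTop atTop :=
    (hr.tendsto_atTop hB (by linarith)).comp tendsto_log_natCast_atTop
  have hlim : Tendsto (fun n : ℕ => (m * (Real.log n - r (Real.log (x n)))) / r (Real.log n)) atTop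
      (𝓝 (-(m * ρ))) := by
    have h1 := ((hr.tendsto_id_div hB hγ).comp tendsto_log_natCast_atTop).sub hxr
    have h2 := h1.const_mul (m : ℝ)
    rw [zero_sub, mul_neg] at h2
    refine h2.congr fun n => ?_
    simp only [Function.comp_apply]
    ring
  refine (expUpperBound_exp ha fun z hz => (hlim.eventually (gt_mem_nhds hz)).mono
    fun n hn => hn.le).mono ?_
  filter_upwards [hx.eventually htail, eventually_gt_atTop 0] with n hn hn0
  refine (measure_le_card_lt_le hindep hid n m (x n)).trans (le_of_eq ?_)
  have hn' : (0 : ℝ) < n := by exact_mod_cast hn0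
  rw [hn, ← mul_pow, Real.exp_nat_mul, ENNReal.ofReal_pow (Real.exp_pos _).le, sub_eq_add_neg,
    Real.exp_add, Real.exp_log hn', ENNReal.ofReal_mul hn'.le, ENNReal.ofReal_natCast]

lemma tendsto_log_mul_div (hr : IsRegularlyVarying r γ) (hB : MonotoneOn r (Set.Ici B)) {x : ℝ}
    (hx : 0 < x) : Tendsto (fun n : ℕ => r (Real.log (n * x)) / r (Real.log n)) atTop (𝓝 1) := by
  refine ((hr.tendsto_add_const_div hB (Real.log x)).comp tendsto_log_natCast_atTop).congr' ?_
  filter_upwards [eventually_gt_atTop 0] with n hn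
  rw [Real.log_mul (by exact_mod_cast hn.ne') hx.ne', Function.comp_apply]

/-- The fourth root of `n`, used as a truncation level. -/
noncomputable def truncLevel (n : ℕ) : ℝ := Real.exp (1 / 4 * Real.log n)

lemma truncLevel_pos (n : ℕ) : 0 < truncLevel n := Real.exp_pos _

lemma tendsto_truncLevel : Tendsto truncLevel atTop atTop :=
  Real.tendsto_exp_atTop.comp (tendsto_log_natCast_atTop.const_mul_atTop (by norm_num))

lemma tendsto_log_truncLevel_div (hr : IsRegularlyVarying r γ) :
    Tendsto (fun n : ℕ => r (Real.log (truncLevel n)) / r (Real.log n)) atTop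
      (𝓝 ((1 / 4) ^ γ)) := by
  simp only [truncLevel, Real.log_exp]
  exact (hr.2 (1 / 4) (by norm_num)).comp tendsto_log_natCast_atTop

lemma eventually_truncLevel_le {δ : ℝ} (hδ : 0 < δ) : ∀ᶠ n : ℕ in atTop, truncLevel n ≤ n * δ := by
  have h : Tendsto (fun n : ℕ => 3 / 4 * Real.log n) atTop atTop :=
    tendsto_log_natCast_atTop.const_mul_atTop (by norm_num)
  filter_upwards [h.eventually_ge_atTop (-Real.log δ), eventually_gt_atTop 0] with n hn hn0
  have hn' : (0 : ℝ) < n := by exact_mod_cast hn0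
  rw [truncLevel]
  nth_rewrite 2 [← Real.exp_log hn']
  rw [← Real.exp_log hδ, ← Real.exp_add]
  exact Real.exp_le_exp.2 (by linarith)

/-- At truncation level `n^(1/4)` the Hoeffding exponent is of order `√n`, far above `r(log n)`;
hence every rate `c` is allowed. -/
lemma expUpperBound_truncAt [IsProbabilityMeasure P] (hm : ∀ i, Measurable (Z i))
    (hindep : iIndepFun Z P) (hid : ∀ i, IdentDistrib (Z i) (Z 0) P P)
    (h0 : ∀ i, ∀ᵐ ω ∂P, 0 ≤ Z i ω) (hint : Integrable (Z 0) P)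
    (hγ : 1 < γ) (hr : IsRegularlyVarying r γ) (hB : MonotoneOn r (Set.Ici B))
    {e : ℝ} (he : 0 < e) (K : ℕ → Finset ℕ) (c : ℝ) :
    ExpUpperBound (fun n => P {ω | ∃ l ≤ n, n * e < |∑ i ∈ Finset.range l \ K n,
        (truncAt (truncLevel n) (Z i ω) - ∫ ω, Z 0 ω ∂P)|})
      (fun n => r (Real.log n)) c := by
  have ha : Tendsto (fun n : ℕ => r (Real.log n)) atTop atTop :=
    (hr.tendsto_atTop hB (by linarith)).comp tendsto_log_natCast_atTop
  -- With `y = log n`, the term `2 * y` absorbs the prefactor, as `2(n + 1) ≤ n^2` for `n ≥ 3`.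
  have hlim : Tendsto (fun y : ℝ => (2 * y - e ^ 2 / 2 * Real.exp (1 / 2 * y)) / r y) atTop
      atBot := by
    have h1 : Tendsto (fun y : ℝ => r y / Real.exp (1 / 2 * y)) atTop (𝓝[>] 0) := by
      refine tendsto_nhdsWithin_iff.2 ⟨hr.tendsto_div_exp hB (by norm_num), ?_⟩
      filter_upwards [hr.eventually_pos] with y hy
      exact div_pos hy (Real.exp_pos _)
    have h2 := (h1.inv_tendsto_nhdsGT_zero).const_mul_atTop (by positivity : 0 < e ^ 2 / 2)
    have h3 := ((hr.tendsto_id_div hB hγ).const_mul 2).add_atBot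
      (tendsto_neg_atTop_atBot.comp h2)
    refine h3.congr fun y => ?_
    simp only [Function.comp_apply, Pi.inv_apply, inv_div]
    ring
  refine (expUpperBound_exp ha fun z _ =>
    (hlim.comp tendsto_log_natCast_atTop).eventually_le_atBot z).mono ?_
  -- Replacing the mean by the truncated mean uses up half of the allowance `n * e`.
  have hμ := ((tendsto_integral_truncAt hint).comp tendsto_truncLevel).eventually
    (Metric.closedBall_mem_nhds _ (half_pos he))
  filter_upwards [hμ, eventually_ge_atTop 3] with n hn hn3
  have hn3' : (3 : ℝ) ≤ n := by exact_mod_cast hn3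
  have hn' : (0 : ℝ) < n := by linarith
  set μ := ∫ ω, truncAt (truncLevel n) (Z 0 ω) ∂P with hμdef
  have hn : |μ - ∫ ω, Z 0 ω ∂P| ≤ e / 2 := hn
  have hsub : {ω | ∃ l ≤ n, n * e < |∑ i ∈ Finset.range l \ K n,
        (truncAt (truncLevel n) (Z i ω) - ∫ ω, Z 0 ω ∂P)|} ⊆
      {ω | ∃ l ≤ n, n * e / 2 < |∑ i ∈ Finset.range l \ K n,
        (truncAt (truncLevel n) (Z i ω) - μ)|} := by
    rintro ω ⟨l, hl, h⟩
    refine ⟨l, hl, ?_⟩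
    have hcard : ((Finset.range l \ K n).card : ℝ) ≤ n := by
      have := Finset.card_le_card (Finset.sdiff_subset : Finset.range l \ K n ⊆ _)
      rw [Finset.card_range] at this
      exact_mod_cast this.trans hl
    have hsplit : ∑ i ∈ Finset.range l \ K n,
        (truncAt (truncLevel n) (Z i ω) - ∫ ω, Z 0 ω ∂P) =
        ∑ i ∈ Finset.range l \ K n, (truncAt (truncLevel n) (Z i ω) - μ) +
          (Finset.range l \ K n).card * (μ - ∫ ω, Z 0 ω ∂P) := by
      rw [← nsmul_eq_mul, ← Finset.sum_const, ← Finset.sum_add_distrib]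
      exact Finset.sum_congr rfl fun i _ => by ring
    rw [hsplit] at h
    have h1 : |((Finset.range l \ K n).card : ℝ) * (μ - ∫ ω, Z 0 ω ∂P)| ≤ n * (e / 2) := by
      rw [abs_mul, Nat.abs_cast]
      exact mul_le_mul hcard hn (abs_nonneg _) hn'.le
    have h2 := abs_add_le (∑ i ∈ Finset.range l \ K n, (truncAt (truncLevel n) (Z i ω) - μ))
      ((Finset.range l \ K n).card * (μ - ∫ ω, Z 0 ω ∂P))
    linarith
  refine (measure_mono hsub).trans ((measure_exists_lt_abs_sum_truncAt_le hm hindep hid h0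
    (truncLevel_pos n) (by positivity) n (K n)).trans ?_)
  have hb : 2 * (n * e / 2) ^ 2 / (n * truncLevel n ^ 2) =
      e ^ 2 / 2 * Real.exp (1 / 2 * Real.log n) := by
    have h1 : (n : ℝ) = Real.exp (1 / 2 * Real.log n) * truncLevel n ^ 2 := by
      rw [truncLevel, ← Real.exp_nat_mul, ← Real.exp_add]
      nth_rewrite 1 [← Real.exp_log hn']
      congr 1
      push_cast
      ring
    have h2 : truncLevel n ≠ 0 := (Real.exp_pos _).ne'
    rw [div_eq_iff (by positivity)]
    calc _ = e ^ 2 / 2 * n * n := by ring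
      _ = e ^ 2 / 2 * n * (Real.exp (1 / 2 * Real.log n) * truncLevel n ^ 2) := by rw [← h1]
      _ = _ := by ring
  have hcast : ((n : ℝ≥0∞) + 1) = ENNReal.ofReal (n + 1) := by
    rw [ENNReal.ofReal_add hn'.le zero_le_one, ENNReal.ofReal_natCast, ENNReal.ofReal_one]
  rw [hb, hcast, ← ENNReal.ofReal_mul (by positivity)]
  refine ENNReal.ofReal_le_ofReal ?_
  rw [← mul_assoc, sub_eq_add_neg, Real.exp_add]
  gcongr
  rw [two_mul, Real.exp_add, Real.exp_log hn']
  nlinarith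

end Asymptotics

/-! ### The upper bound. -/

open CadlagPath

section UpperBound

variable {Ω : Type*} [MeasurableSpace Ω] {P : Measure Ω} [IsProbabilityMeasure P]
  {Z : ℕ → Ω → ℝ} {r : ℝ → ℝ} {γ B : ℝ}

lemma expUpperBound_centeredWalk_mem (hm : ∀ i, Measurable (Z i))
    (hindep : iIndepFun Z P) (hid : ∀ i, IdentDistrib (Z i) (Z 0) P P)
    (h0 : ∀ i, ∀ᵐ ω ∂P, 0 ≤ Z i ω) (hint : Integrable (Z 0) P)
    (hγ : 1 < γ) (hr : IsRegularlyVarying r γ) (hB : MonotoneOn r (Set.Ici B))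
    (htail : ∀ᶠ x : ℝ in atTop, P {ω | x < Z 0 ω} = ENNReal.ofReal (Real.exp (-r (Real.log x))))
    {F : Set CadlagPath} {k : ℕ} {ε : ℝ} (hε : 0 < ε)
    (hF : ∀ ζ ∈ Metric.cthickening ε F, ((k + 1 : ℕ) : ℝ≥0∞) ≤ jumpRate ζ) :
    ExpUpperBound (fun n => P {ω | centeredWalk n (fun i => Z i ω) (∫ ω, Z 0 ω ∂P) ∈ F})
      (fun n => r (Real.log n)) (k + 1 : ℕ) := by
  have ha : Tendsto (fun n : ℕ => r (Real.log n)) atTop atTop :=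
    (hr.tendsto_atTop hB (by linarith)).comp tendsto_log_natCast_atTop
  have hq : (0 : ℝ) < (1 / 4) ^ γ := by positivity
  -- Exceeding `n^(1/4)` costs `(1/4)^γ` per increment, so `M` such exceedances cost at least `k +
  -- 1`.
  obtain ⟨M, hM⟩ := exists_nat_ge (((k + 1 : ℕ) : ℝ) / (1 / 4) ^ γ)
  rw [div_le_iff₀ hq] at hM
  have hM0 : (0 : ℝ) < M := by
    by_contra! h
    have : (0 : ℝ) < (k + 1 : ℕ) := by positivity
    nlinarith
  have hδ : 0 < ε / 2 / M := by positivity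
  have h1 := expUpperBound_card_lt hindep hid hγ hr hB htail
    (tendsto_natCast_atTop_atTop.atTop_mul_const hδ) (tendsto_log_mul_div hr hB hδ) (k + 1)
  rw [mul_one] at h1
  have h2 := (expUpperBound_card_lt hindep hid hγ hr hB htail
    tendsto_truncLevel (tendsto_log_truncLevel_div hr) M).anti ha hM
  have h3 := expUpperBound_truncAt hm hindep hid h0 hint hγ hr hB (half_pos hε) (fun _ => ∅)
    (k + 1 : ℕ)
  refine ((h1.add ha h2).add ha h3).mono ?_
  filter_upwards [eventually_truncLevel_le hδ, eventually_gt_atTop 0] with n hb hn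
  have hnull : P {ω | ¬ ∀ i, 0 ≤ Z i ω} = 0 := ae_iff.1 (ae_all_iff.2 h0)
  refine (measure_mono (t := (({ω | k + 1 ≤ ((Finset.range n).filter fun i =>
      n * (ε / 2 / M) < Z i ω).card} ∪
    {ω | M ≤ ((Finset.range n).filter fun i => truncLevel n < Z i ω).card}) ∪
    {ω | ∃ l ≤ n, n * (ε / 2) < |∑ i ∈ Finset.range l \ ∅,
      (truncAt (truncLevel n) (Z i ω) - ∫ ω, Z 0 ω ∂P)|}) ∪ {ω | ¬ ∀ i, 0 ≤ Z i ω}) ?_).trans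
    ((measure_union_le _ _).trans ?_)
  rotate_left
  · rw [hnull, add_zero]
    exact (measure_union_le _ _).trans (add_le_add (measure_union_le _ _) le_rfl)
  intro ω hω
  by_contra hcon
  simp only [Set.mem_union, Set.mem_ofPred_eq, not_or, not_not, not_le, not_exists, not_and,
    not_lt, Finset.sdiff_empty] at hcon
  obtain ⟨⟨⟨c1, c2⟩, c3⟩, c4⟩ := hcon
  obtain ⟨ζ, hζ, hd⟩ := exists_jumpRate_le_edist_le (z := fun i => Z i ω)
    (m := ∫ ω, Z 0 ω ∂P) hn (fun i _ => c4 i) hδ (half_pos hε) hb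
    (by rw [mul_div_cancel₀ _ hM0.ne']) (Nat.lt_succ_iff.1 c1) c2.le c3
  rw [mul_div_cancel₀ _ two_ne_zero, edist_comm] at hd
  have hω' : centeredWalk n (fun i => Z i ω) (∫ ω, Z 0 ω ∂P) ∈ F := hω
  have h4 := (hF ζ (Metric.mem_cthickening_iff.2
    ((Metric.infEDist_le_edist_of_mem hω').trans hd))).trans hζ
  have h5 : k + 1 ≤ k := by exact_mod_cast h4
  omega

end UpperBound

lemma limsup_log_div_le_zero {p : ℕ → ℝ≥0∞} {a : ℕ → ℝ} (ha : Tendsto a atTop atTop)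
    (hp : ∀ n, p n ≤ 1) : limsup (fun n => ENNReal.log (p n) / (a n : EReal)) atTop ≤ 0 := by
  refine limsup_le_of_le (h := ?_)
  filter_upwards [ha.eventually_gt_atTop 0] with n hn
  rw [EReal.div_le_iff_le_mul (by exact_mod_cast hn) (EReal.coe_ne_top _), mul_zero]
  exact ENNReal.log_le_zero_iff.2 (hp n)

/-- For finite `L > 0` take `k = ⌈L⌉ - 1 < L`, so that `k + 1 ≥ L`; for `L = ∞` use all `k`; for `L
= 0` no `k` is available and `h0` is needed. -/
lemma le_neg_coe_of_forall_natCast {x : EReal} {L : ℝ≥0∞} (h0 : x ≤ 0)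
    (h : ∀ k : ℕ, (k : ℝ≥0∞) < L → x ≤ ((-(k + 1 : ℕ) : ℝ) : EReal)) : x ≤ -(L : EReal) := by
  rcases eq_or_ne L ⊤ with rfl | hL
  · rw [EReal.coe_ennreal_top, EReal.neg_top, le_bot_iff, EReal.eq_bot_iff_forall_lt]
    intro y
    obtain ⟨k, hk⟩ := exists_nat_gt (-y)
    refine (h k (ENNReal.natCast_lt_top k)).trans_lt ?_
    have : -((k + 1 : ℕ) : ℝ) < y := by push_cast; linarith
    exact_mod_cast this
  · lift L to NNReal using hL
    rcases eq_or_ne L 0 with rfl | hL0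
    · simpa using h0
    have hc : 0 < ⌈L⌉₊ := Nat.ceil_pos.2 (pos_iff_ne_zero.2 hL0)
    have h1 : ((⌈L⌉₊ - 1 : ℕ) : NNReal) < L := Nat.lt_ceil.1 (by omega)
    refine (h (⌈L⌉₊ - 1) (by exact_mod_cast h1)).trans ?_
    rw [Nat.sub_add_cancel hc]
    have h2 : (L : ℝ) ≤ (⌈L⌉₊ : ℝ) := by exact_mod_cast Nat.le_ceil L
    rw [EReal.coe_nnreal_eq_coe_real, ← EReal.coe_neg, EReal.coe_le_coe_iff]
    linarith

/-! ### The lower bound. -/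

section LowerBound

variable {Ω : Type*} [MeasurableSpace Ω] {P : Measure Ω} {Z : ℕ → Ω → ℝ} {r : ℝ → ℝ} {γ B : ℝ}

/-- By the gap hypothesis the tail at `n x₂` is eventually at most half the tail at `n x₁`, so the
window keeps the other half. -/
lemma eventually_le_measure_mem_Ioc [IsProbabilityMeasure P] (hm : ∀ i, Measurable (Z i))
    (hid : ∀ i, IdentDistrib (Z i) (Z 0) P P)
    (hgap : ∀ x₁ x₂ : ℝ, 0 < x₁ → x₁ < x₂ →
      Tendsto (fun n : ℕ => r (Real.log (n * x₁)) - r (Real.log (n * x₂))) atTop atBot)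
    (htail : ∀ᶠ x : ℝ in atTop, P {ω | x < Z 0 ω} = ENNReal.ofReal (Real.exp (-r (Real.log x))))
    {x₁ x₂ : ℝ} (h1 : 0 < x₁) (h12 : x₁ < x₂) :
    ∀ᶠ n : ℕ in atTop, ∀ i, ENNReal.ofReal (Real.exp (-Real.log 2 - r (Real.log (n * x₁)))) ≤
      P (Z i ⁻¹' Set.Ioc (n * x₁) (n * x₂)) := by
  have ht : ∀ {x : ℝ}, 0 < x → Tendsto (fun n : ℕ => (n : ℝ) * x) atTop atTop := fun hx =>
    tendsto_natCast_atTop_atTop.atTop_mul_const hx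
  filter_upwards [(hgap x₁ x₂ h1 h12).eventually_le_atBot (-Real.log 2),
    (ht h1).eventually htail, (ht (h1.trans h12)).eventually htail] with n hn hx1 hx2 i
  rw [(hid i).measure_mem_eq measurableSet_Ioc]
  have hset : Z 0 ⁻¹' Set.Ioc (n * x₁) (n * x₂) = {ω | n * x₁ < Z 0 ω} \ {ω | n * x₂ < Z 0 ω} := by
    ext ω
    simp [not_lt]
  have hsub : {ω | n * x₂ < Z 0 ω} ⊆ {ω | n * x₁ < Z 0 ω} := fun ω hω =>
    (mul_le_mul_of_nonneg_left h12.le (Nat.cast_nonneg n)).trans_lt hω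
  have hmeas : MeasurableSet {ω | n * x₂ < Z 0 ω} := hm 0 measurableSet_Ioi
  rw [hset, measure_sdiff hsub hmeas.nullMeasurableSet (measure_ne_top _ _), hx1, hx2,
    ← ENNReal.ofReal_sub _ (Real.exp_pos _).le]
  refine ENNReal.ofReal_le_ofReal ?_
  have h3 : Real.exp (-r (Real.log (n * x₂))) ≤
      Real.exp (-Real.log 2 - r (Real.log (n * x₁))) := Real.exp_le_exp.2 (by linarith)
  have h4 : Real.exp (-Real.log 2 - r (Real.log (n * x₁))) =
      1 / 2 * Real.exp (-r (Real.log (n * x₁))) := by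
    rw [sub_eq_add_neg, Real.exp_add, Real.exp_neg, Real.exp_log two_pos, one_div]
  linarith

/-- Independence of the increments with indices in `K` from partial sums of the others. -/
lemma measure_inter_of_disjoint [IsProbabilityMeasure P] (hm : ∀ i, Measurable (Z i))
    (hindep : iIndepFun Z P) {ι : Type*} (J : Finset ι) (κ : ι → ℕ) (hκ : Set.InjOn κ J)
    (S : ι → Set ℝ) (hS : ∀ u ∈ J, MeasurableSet (S u)) (n : ℕ) (m e : ℝ) :
    P ((⋂ u ∈ J, Z (κ u) ⁻¹' S u) ∩
      {ω | ∀ l ≤ n, |∑ i ∈ Finset.range l \ J.image κ, (Z i ω - m)| ≤ e}) =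
      (∏ u ∈ J, P (Z (κ u) ⁻¹' S u)) *
        P {ω | ∀ l ≤ n, |∑ i ∈ Finset.range l \ J.image κ, (Z i ω - m)| ≤ e} := by
  classical
  set K := J.image κ with hK
  set T := Finset.range n \ K with hT
  have hprod : P (⋂ u ∈ J, Z (κ u) ⁻¹' S u) = ∏ u ∈ J, P (Z (κ u) ⁻¹' S u) := by
    have h1 := (hindep.precomp (g := fun u : J => κ u)
      (fun u w h => Subtype.ext (hκ u.2 w.2 h))).measure_inter_preimage_eq_mul Finset.univ
      (sets := fun u => S u) fun u _ => hS u u.2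
    rw [Finset.prod_coe_sort J fun u => P (Z (κ u) ⁻¹' S u)] at h1
    rw [← h1]
    congr 1
    ext ω
    simp
  have hi := hindep.indepFun_finset K T Finset.disjoint_sdiff hm
  let A : Set (K → ℝ) := ⋂ u : J, {x | x ⟨κ u, Finset.mem_image_of_mem κ u.2⟩ ∈ S u}
  -- The default `0` is never read: for `l ≤ n` the sums only involve indices in `T`.
  let ext : (T → ℝ) → ℕ → ℝ := fun x i => if h : i ∈ T then x ⟨i, h⟩ else 0
  let D : Set (T → ℝ) := ⋂ l : Fin (n + 1), {x | |∑ i ∈ Finset.range l \ K, (ext x i - m)| ≤ e}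
  have hA : MeasurableSet A := MeasurableSet.iInter fun u =>
    measurable_pi_apply (⟨κ u, Finset.mem_image_of_mem κ u.2⟩ : K) (hS u u.2)
  have hext : ∀ i, Measurable fun x => ext x i := by
    intro i
    by_cases h : i ∈ T
    · simp only [ext, dif_pos h]
      exact measurable_pi_apply _
    · simp only [ext, dif_neg h]
      exact measurable_const
  have hD : MeasurableSet D := MeasurableSet.iInter fun l =>
    measurableSet_le (Measurable.abs (Finset.measurable_fun_sum _ fun i _ =>
      (hext i).sub_const m)) measurable_const
  have hA' : (⋂ u ∈ J, Z (κ u) ⁻¹' S u) = (fun ω (i : K) => Z i ω) ⁻¹' A := by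
    ext ω
    simp [A]
  have hD' : {ω | ∀ l ≤ n, |∑ i ∈ Finset.range l \ K, (Z i ω - m)| ≤ e} =
      (fun ω (i : T) => Z i ω) ⁻¹' D := by
    have hsum : ∀ l ≤ n, ∀ ω, ∑ i ∈ Finset.range l \ K, (ext (fun i : T => Z i ω) i - m) =
        ∑ i ∈ Finset.range l \ K, (Z i ω - m) := by
      intro l hl ω
      refine Finset.sum_congr rfl fun i hi => ?_
      have : i ∈ T := Finset.sdiff_subset_sdiff (Finset.range_mono hl) subset_rfl hi
      simp only [ext, dif_pos this]
    ext ω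
    simp only [Set.mem_ofPred_eq, Set.mem_preimage, D, Set.mem_iInter]
    constructor
    · intro h l
      rw [hsum l (Nat.lt_succ_iff.1 l.2)]
      exact h l (Nat.lt_succ_iff.1 l.2)
    · intro h l hl
      have := h ⟨l, Nat.lt_succ_of_le hl⟩
      rwa [hsum l hl] at this
  rw [← hprod, hA', hD']
  exact hi.measure_inter_preimage_eq_mul A D hA hD

/-- When no increment exceeds `n^(1/4)` truncation changes nothing, and both this and the truncated
deviation bound fail with vanishing probability. -/
lemma eventually_half_le_measure [IsProbabilityMeasure P] (hm : ∀ i, Measurable (Z i))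
    (hindep : iIndepFun Z P) (hid : ∀ i, IdentDistrib (Z i) (Z 0) P P)
    (h0 : ∀ i, ∀ᵐ ω ∂P, 0 ≤ Z i ω) (hint : Integrable (Z 0) P)
    (hγ : 1 < γ) (hr : IsRegularlyVarying r γ) (hB : MonotoneOn r (Set.Ici B))
    (htail : ∀ᶠ x : ℝ in atTop, P {ω | x < Z 0 ω} = ENNReal.ofReal (Real.exp (-r (Real.log x))))
    {e : ℝ} (he : 0 < e) (K : ℕ → Finset ℕ) :
    ∀ᶠ n : ℕ in atTop, ENNReal.ofReal (1 / 2) ≤ P {ω | ∀ l ≤ n,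
      |∑ i ∈ Finset.range l \ K n, (Z i ω - ∫ ω, Z 0 ω ∂P)| ≤ n * e} := by
  have ha : Tendsto (fun n : ℕ => r (Real.log n)) atTop atTop :=
    (hr.tendsto_atTop hB (by linarith)).comp tendsto_log_natCast_atTop
  have hq : (0 : ℝ) < ((1 : ℕ) : ℝ) * (1 / 4) ^ γ := by positivity
  have h1 := expUpperBound_card_lt hindep hid hγ hr hB htail
    tendsto_truncLevel (tendsto_log_truncLevel_div hr) 1
  have h2 := expUpperBound_truncAt hm hindep hid h0 hint hγ hr hB he K
    (((1 : ℕ) : ℝ) * (1 / 4) ^ γ)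
  filter_upwards [(h1.add ha h2).eventually_le ha hq (half_pos one_pos)] with n hn
  set E := {ω | ∀ l ≤ n, |∑ i ∈ Finset.range l \ K n, (Z i ω - ∫ ω, Z 0 ω ∂P)| ≤ n * e} with hE
  have hsub : Eᶜ ⊆ {ω | 1 ≤ ((Finset.range n).filter fun i => truncLevel n < Z i ω).card} ∪
      {ω | ∃ l ≤ n, n * e < |∑ i ∈ Finset.range l \ K n,
        (truncAt (truncLevel n) (Z i ω) - ∫ ω, Z 0 ω ∂P)|} := by
    intro ω hω
    by_contra hcon
    simp only [Set.mem_union, Set.mem_ofPred_eq, not_or, not_le, not_exists, not_and, not_lt,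
      Nat.lt_one_iff, Finset.card_eq_zero, Finset.filter_eq_empty_iff, Finset.mem_range] at hcon
    refine hω fun l hl => ?_
    refine le_of_eq_of_le (congrArg _ (Finset.sum_congr rfl fun i hi => ?_)) (hcon.2 l hl)
    have hi' : i < n := (Finset.mem_range.1 (Finset.mem_sdiff.1 hi).1).trans_le hl
    rw [truncAt, if_pos (hcon.1 hi')]
  have h3 : P Eᶜ ≤ ENNReal.ofReal (1 / 2) :=
    (measure_mono hsub).trans ((measure_union_le _ _).trans hn)
  have h4 : 1 ≤ P E + P Eᶜ := by
    rw [← measure_univ (μ := P), ← Set.union_compl_self E]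
    exact measure_union_le _ _
  have h5 : ENNReal.ofReal (1 / 2) + ENNReal.ofReal (1 / 2) ≤ P E + ENNReal.ofReal (1 / 2) := by
    rw [← ENNReal.ofReal_add (by norm_num) (by norm_num), add_halves, ENNReal.ofReal_one]
    exact h4.trans (by gcongr)
  exact (ENNReal.add_le_add_iff_right ENNReal.ofReal_ne_top).1 h5

end LowerBound

section LowerBound

variable {Ω : Type*} [MeasurableSpace Ω] {P : Measure Ω} {Z : ℕ → Ω → ℝ} {r : ℝ → ℝ} {γ B : ℝ}

lemma neg_natCast_le_liminf [IsProbabilityMeasure P] (hm : ∀ i, Measurable (Z i))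
    (hindep : iIndepFun Z P) (hid : ∀ i, IdentDistrib (Z i) (Z 0) P P)
    (h0 : ∀ i, ∀ᵐ ω ∂P, 0 ≤ Z i ω) (hint : Integrable (Z 0) P)
    (hγ : 1 < γ) (hr : IsRegularlyVarying r γ) (hB : MonotoneOn r (Set.Ici B))
    (hgap : ∀ x₁ x₂ : ℝ, 0 < x₁ → x₁ < x₂ →
      Tendsto (fun n : ℕ => r (Real.log (n * x₁)) - r (Real.log (n * x₂))) atTop atBot)
    (htail : ∀ᶠ x : ℝ in atTop, P {ω | x < Z 0 ω} = ENNReal.ofReal (Real.exp (-r (Real.log x))))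
    {G : Set CadlagPath} (hG : IsOpen G) {ξ : CadlagPath} (hξG : ξ ∈ G) {j : ℕ}
    (hξ : ξ ∈ stepPathsEq j) :
    ((-(j : ℝ) : ℝ) : EReal) ≤ liminf (fun n : ℕ => ENNReal.log
      (P {ω | centeredWalk n (fun i => Z i ω) (∫ ω, Z 0 ω ∂P) ∈ G}) /
        ((r (Real.log n) : ℝ) : EReal)) atTop := by
  have ha : Tendsto (fun n : ℕ => r (Real.log n)) atTop atTop :=
    (hr.tendsto_atTop hB (by linarith)).comp tendsto_log_natCast_atTop
  obtain ⟨hmono, hpure, hzero, hj⟩ := hξ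
  have hfin : ξ.jumpTimes.Finite := Set.finite_of_encard_eq_coe hj
  rw [ξ.isPureJump_iff hfin] at hpure
  set J := hfin.toFinset with hJdef
  have hcard : J.card = j := by
    rw [numJumps, hfin.encard_eq_coe_toFinset_card] at hj
    exact_mod_cast hj
  have hJ0 : (0 : unitInterval) ∉ J := by
    simpa [hJdef] using ξ.notMem_jumpTimes_zero hzero
  have hΔ : ∀ u ∈ J, 0 < ξ u - ξ.leftLimit u := by
    intro u hu
    have : ξ u ≠ ξ.leftLimit u := by simpa [hJdef, jumpTimes] using hu
    exact sub_pos.2 (lt_of_le_of_ne (ξ.leftLimit_le hmono hzero u) this.symm)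
  obtain ⟨ε', hε', hball⟩ := EMetric.isOpen_iff.1 hG ξ hξG
  obtain ⟨ε, hε0, hεε'⟩ : ∃ ε : ℝ, 0 < ε ∧ ENNReal.ofReal ε ≤ ε' := by
    have h1 : min ε' 1 ≠ ⊤ := (min_le_right _ _).trans_lt ENNReal.one_lt_top |>.ne
    refine ⟨(min ε' 1).toReal, ENNReal.toReal_pos (lt_min hε' one_pos).ne' h1, ?_⟩
    rw [ENNReal.ofReal_toReal h1]
    exact min_le_left _ _
  set m := ∫ ω, Z 0 ω ∂P with hmdef
  -- Chosen so that `e + J.card * e = ε / 2`, leaving `ε / 2` for the centring at the jump indices.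
  set e := ε / (2 * (J.card + 1)) with hedef
  have he : 0 < e := by positivity
  obtain ⟨c, hc, hlam⟩ := exists_timeChange_moving J hJ0
  have hinv : ∀ C : ℝ, Tendsto (fun n : ℕ => C / n) atTop (𝓝 0) := fun C =>
    tendsto_const_div_atTop_nhds_zero_nat C
  have hterm : ∀ᶠ n : ℕ in atTop, ∀ u ∈ J, ∀ i,
      ENNReal.ofReal (Real.exp (-Real.log 2 - r (Real.log (n * (ξ u - ξ.leftLimit u))))) ≤
        P (Z i ⁻¹' Set.Ioc (n * (ξ u - ξ.leftLimit u)) (n * (ξ u - ξ.leftLimit u + e))) := by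
    rw [eventually_all_finset]
    exact fun u hu => eventually_le_measure_mem_Ioc hm hid hgap htail (hΔ u hu)
      (lt_add_of_pos_right _ he)
  have hhalf := eventually_half_le_measure hm hindep hid h0 hint hγ hr hB htail he
    fun n => J.image fun u : unitInterval => ⌈(n : ℝ) * u⌉₊ - 1
  -- Log-probability of the windows plus `log (1/2)` for the rest; after division by the speed each
  -- jump contributes `-1` and the constants vanish.
  set f : ℕ → ℝ := fun n => ∑ u ∈ J, (-Real.log 2 - r (Real.log (n * (ξ u - ξ.leftLimit u)))) +
    -Real.log 2 with hf
  have hflim : Tendsto (fun n : ℕ => f n / r (Real.log n)) atTop (𝓝 (-(j : ℝ))) := by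
    have h1 : Tendsto (fun n : ℕ => -Real.log 2 / r (Real.log n)) atTop (𝓝 0) :=
      ha.const_div_atTop _
    have h2 := (tendsto_finsetSum J fun u hu =>
      h1.sub (tendsto_log_mul_div hr hB (hΔ u hu))).add h1
    simp only [zero_sub, Finset.sum_neg_distrib, Finset.sum_const, hcard, nsmul_eq_mul, mul_one,
      add_zero] at h2
    refine h2.congr fun n => ?_
    rw [hf]
    simp only [add_div, Finset.sum_div, sub_div]
  refine le_liminf_log_div ha ?_ hflim
  filter_upwards [hterm, hhalf, (hinv 1).eventually (gt_mem_nhds hc),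
    (hinv J.card).eventually (gt_mem_nhds hε0),
    (hinv (J.card * |m|)).eventually (gt_mem_nhds (half_pos hε0)),
    eventually_gt_atTop 0] with n hn1 hn2 hn3 hn4 hn5 hn
  have hn' : (0 : ℝ) < n := by exact_mod_cast hn
  have hv : ∀ u : unitInterval, (⌈(n : ℝ) * u⌉₊ : ℝ) / n ∈ unitInterval := fun u => by
    refine ⟨by positivity, ?_⟩
    rw [div_le_one hn', Nat.cast_le, Nat.ceil_le]
    exact mul_le_of_le_one_right hn'.le u.2.2
  obtain ⟨lam, hlam1, hlam2⟩ := hlam (fun u => ⟨_, hv u⟩) (1 / n) hn3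
    (fun u _ hu => Subtype.ext (by simp [hu, hn'.ne'])) fun u _ => by
      have h1 := Nat.le_ceil ((n : ℝ) * u)
      have h2 := Nat.ceil_lt_add_one (mul_nonneg hn'.le u.2.1)
      have h3 : (⌈(n : ℝ) * u⌉₊ : ℝ) / n - u = (⌈(n : ℝ) * u⌉₊ - n * u) / n := by field_simp
      rw [h3, abs_of_nonneg (div_nonneg (sub_nonneg.2 h1) hn'.le)]
      gcongr
      linarith
  have hlam3 : ∀ u ∈ J, (lam u : ℝ) = ⌈(n : ℝ) * u⌉₊ / n := fun u hu => by rw [hlam1 u hu]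
  have hinj : Set.InjOn (fun u : unitInterval => ⌈(n : ℝ) * u⌉₊ - 1) J := by
    intro u hu w hw huw
    have hpos : ∀ u ∈ J, 0 < ⌈(n : ℝ) * u⌉₊ := fun u hu => Nat.ceil_pos.2
      (mul_pos hn' (unitInterval.pos_iff_ne_zero.2 fun h => hJ0 (h ▸ hu)))
    have h1 := hpos u hu
    have h2 := hpos w hw
    have h3 : ⌈(n : ℝ) * u⌉₊ = ⌈(n : ℝ) * w⌉₊ := by simp only at huw; omega
    refine lam.injective (Subtype.ext ?_)
    rw [hlam3 u hu, hlam3 w hw, h3]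
  have hind := measure_inter_of_disjoint hm hindep J
    (fun u : unitInterval => ⌈(n : ℝ) * u⌉₊ - 1) hinj
    (fun u => Set.Ioc (n * (ξ u - ξ.leftLimit u)) (n * (ξ u - ξ.leftLimit u + e)))
    (fun _ _ => measurableSet_Ioc) n m (n * e)
  calc ENNReal.ofReal (Real.exp (f n)) =
        (∏ u ∈ J, ENNReal.ofReal
          (Real.exp (-Real.log 2 - r (Real.log (n * (ξ u - ξ.leftLimit u)))))) *
          ENNReal.ofReal (1 / 2) := by
        rw [← ENNReal.ofReal_prod_of_nonneg fun _ _ => (Real.exp_pos _).le, ← Real.exp_sum,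
          ← ENNReal.ofReal_mul (Real.exp_pos _).le, hf, Real.exp_add, Real.exp_neg (Real.log 2),
          Real.exp_log two_pos, one_div]
    _ ≤ _ := mul_le_mul' (Finset.prod_le_prod' fun u hu => hn1 u hu _) hn2
    _ = _ := hind.symm
    _ ≤ _ := measure_mono fun ω hω => hball ?_
  obtain ⟨hω1, hω2⟩ := hω
  rw [Set.mem_iInter₂] at hω1
  rw [Set.mem_ofPred_eq] at hω2
  have hd := edist_centeredWalk_le hn (z := fun i => Z i ω) (m := m) hJ0 hpure lam hlam3 hlam2 he.le
    (fun u hu => ?_) hω2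
  · rw [Metric.mem_eball]
    refine (hd.trans_lt ?_).trans_le hεε'
    refine (ENNReal.ofReal_lt_ofReal_iff hε0).2 (max_lt (by simpa [div_eq_mul_inv] using hn4) ?_)
    have h1 : e + J.card * e = ε / 2 := by
      rw [hedef]
      field_simp
      ring
    linarith
  · have h1 := hω1 u hu
    rw [Set.mem_preimage, Set.mem_Ioc] at h1
    have h2 : ξ u - ξ.leftLimit u < Z (⌈(n : ℝ) * u⌉₊ - 1) ω / n := by
      rw [lt_div_iff₀' hn']
      exact h1.1
    have h3 : Z (⌈(n : ℝ) * u⌉₊ - 1) ω / n ≤ ξ u - ξ.leftLimit u + e := by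
      rw [div_le_iff₀' hn']
      exact h1.2
    rw [abs_of_pos (sub_pos.2 h2)]
    linarith

end LowerBound

/-! ### Assembling the large deviation principle. -/

lemma neg_iInf_le_of_forall {X : Type*} {G : Set X} {I : X → ℝ≥0∞} {y : EReal}
    (h : ∀ x ∈ G, -(I x : EReal) ≤ y) : -((⨅ x ∈ G, I x : ℝ≥0∞) : EReal) ≤ y := by
  by_contra! hlt
  have h1 : ((⨅ x ∈ G, I x : ℝ≥0∞) : EReal) < -y := EReal.lt_neg_comm.1 hlt
  have h2 : (0 : EReal) ≤ -y := (EReal.coe_ennreal_nonneg _).trans h1.le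
  rw [← EReal.coe_toENNReal h2, EReal.coe_ennreal_lt_coe_ennreal_iff, iInf_lt_iff] at h1
  obtain ⟨x, hx⟩ := h1
  obtain ⟨hxG, hx⟩ := iInf_lt_iff.1 hx
  rw [← EReal.coe_ennreal_lt_coe_ennreal_iff, EReal.coe_toENNReal h2] at hx
  exact (h x hxG).not_gt (EReal.lt_neg_comm.1 hx)

theorem mainTheorem2 {Ω : Type*} [MeasurableSpace Ω] (P : Measure Ω) [IsProbabilityMeasure P]
    (Z : ℕ → Ω → ℝ) (hZ_meas : ∀ i, Measurable (Z i))
    (hZ_indep : iIndepFun Z P) (hZ_ident : ∀ i, IdentDistrib (Z i) (Z 0) P P)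
    (hZ_nonneg : ∀ᵐ ω ∂P, 0 ≤ Z 0 ω)
    (r : ℝ → ℝ) (γ : ℝ) (hγ : 1 < γ) (hr : IsRegularlyVarying r γ)
    (hr_gap : ∀ x₁ x₂ : ℝ, 0 < x₁ → x₁ < x₂ →
      Tendsto (fun n : ℕ => r (Real.log (n * x₁)) - r (Real.log (n * x₂))) atTop atBot)
    (hZ_tail : ∀ᶠ x : ℝ in atTop,
      P {ω | x < Z 0 ω} = ENNReal.ofReal (Real.exp (-r (Real.log x)))) :
    SatisfiesExtendedLDP P
      (fun n ω => CadlagPath.centeredWalk n (fun i => Z i ω) (∫ ω', Z 0 ω' ∂P))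
      CadlagPath.jumpRate
      (fun n => r (Real.log n)) := by
  obtain ⟨B, hB⟩ := monotoneOn_of_tail hZ_tail
  have hint := integrable_of_tail (hZ_meas 0) hZ_nonneg hγ hr hZ_tail
  have h0 : ∀ i, ∀ᵐ ω ∂P, 0 ≤ Z i ω := fun i =>
    (hZ_ident i).symm.ae_mem_snd measurableSet_Ici hZ_nonneg
  have ha : Tendsto (fun n : ℕ => r (Real.log n)) atTop atTop :=
    (hr.tendsto_atTop hB (by linarith)).comp tendsto_log_natCast_atTop
  have hW := fun n => measurable_centeredWalk hZ_meas n (∫ ω', Z 0 ω' ∂P)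
  refine ⟨hW, lowerSemicontinuous_jumpRate, ha, fun G hG => ?_, fun F hF => ?_⟩
  · have hmap : ∀ n, (P.map fun ω => centeredWalk n (fun i => Z i ω) (∫ ω', Z 0 ω' ∂P)) G =
        P {ω | centeredWalk n (fun i => Z i ω) (∫ ω', Z 0 ω' ∂P) ∈ G} := fun n =>
      Measure.map_apply (hW n) hG.measurableSet
    simp only [hmap]
    refine neg_iInf_le_of_forall fun ξ hξ => ?_
    rcases ξ.jumpRate_eq with h | ⟨j, hj, h⟩
    · simp [h]
    · rw [h]
      exact neg_natCast_le_liminf hZ_meas hZ_indep hZ_ident h0 hint hγ hr hB hr_gap hZ_tail hG hξ hj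
  · have hmap : ∀ n, (P.map fun ω => centeredWalk n (fun i => Z i ω) (∫ ω', Z 0 ω' ∂P)) F =
        P {ω | centeredWalk n (fun i => Z i ω) (∫ ω', Z 0 ω' ∂P) ∈ F} := fun n =>
      Measure.map_apply (hW n) hF.measurableSet
    simp only [hmap]
    -- The infimum grows as the fattening shrinks, so the limit exists; the bound is shown for each
    -- `ε > 0` and then passed to the limit.
    have hanti : Antitone fun ε : ℝ => ⨅ x ∈ Metric.cthickening ε F, jumpRate x := fun s t hst =>
      biInf_mono (Metric.cthickening_mono hst F)
    have hlim := hanti.tendsto_nhdsGT 0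
    refine ⟨_, hlim, ?_⟩
    refine ge_of_tendsto
      ((continuous_neg.comp continuous_coe_ennreal_ereal).continuousAt.tendsto.comp hlim) ?_
    filter_upwards [self_mem_nhdsWithin] with ε hε
    refine le_neg_coe_of_forall_natCast (limsup_log_div_le_zero ha fun n => prob_le_one)
      fun k hk => ?_
    refine (expUpperBound_centeredWalk_mem hZ_meas hZ_indep hZ_ident h0 hint hγ hr hB hZ_tail hε
      fun ζ hζ => ?_).limsup_le ha
    -- Rates are integers or `∞`, so exceeding `k` means being at least `k + 1`.
    have h1 : (k : ℝ≥0∞) < jumpRate ζ := hk.trans_le (iInf₂_le ζ hζ)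
    rcases ζ.jumpRate_eq with h | ⟨j, -, h⟩
    · simp [h]
    · rw [h] at h1 ⊢
      have h2 : k < j := by exact_mod_cast h1
      exact_mod_cast h2
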